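/- Let $(R,\mathfrak m)$ be a Noetherian local ring (commutative, with unity) of Krull dimension $2$, and let $\sigma,\tau$ be a system of parameters of $R$, that is, $\sigma,\tau\in\mathfrak m$ and the ideal $(\sigma,\tau)R$ is $\mathfrak m$-primary. Let $n\ge 0$ and let $S=R[x_1,\dots,x_n]$ be the polynomial ring. Then for every ideal $J\subseteq S$ and every $i\ge 0$, the set of those associated primes $\mathfrak p\in\operatorname{Ass}_S H^i_J(S)$ of the local cohomology module $H^i_J(S)=\varinjlim_t\operatorname{Ext}^i_S(S/J^t,S)$ that contain exactly one of the two elements $\sigma,\tau$ (i.e. $\tau\in\mathfrak p$ and $\sigma\notin\mathfrak p$, or $\sigma\in\mathfrak p$ and $\tau\notin\mathfrak p$) is finite. -/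

import Mathlib

universe u

/-- A family `x` of `d` elements of a local ring `R` is a system of parameters if `d = dim R` and
`x` generates an ideal that is primary to the maximal ideal, i.e. whose radical is the maximal
ideal. -/
def IsSystemOfParameters {R : Type*} [CommRing R] [IsLocalRing R] {d : ℕ} (x : Fin d → R) : Prop :=
  ringKrullDim R = d ∧
    (Ideal.span (Set.range x)).radical = IsLocalRing.maximalIdeal R

/-!
Let `S = R[x₁, …, xₙ]`. A prime `P` of `S` that contains `τ` but not `σ` lies over a prime of `R`
which is not maximal, and by Krull's principal ideal theorem, applied to `σ` modulo `τ`, this prime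
is minimal over `τ`. As there are finitely many such primes, it is enough to fix one of them, `q`,
and to show that only finitely many associated primes of `H^i_J(S)` lie over `q`
(`HasseOperators.finite_associatedPrimes_localCohomology`).

The proof uses differential operators in the style of Lyubeznik, but neither a field nor a regular
ring `R` is available. The operators are the polynomials and the divided power derivatives `∂_b`;
`DOp R n` is the ring they generate, subject to the Leibniz rule only. Its modules localize,
because the Taylor expansion `m ↦ ∑ ∂_b(m) h ^ b` extends to localizations. Finite length is
replaced by a growth condition. A module over `DOp R n` killed by `q` has bounded growth (`HasGrowth`)
if it has a filtration, compatible with the Bernstein filtration of the operators, whose `j`-th step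
has rank `O(j ^ n)` over the domain `R ⧸ q`. For such a module:

* Submodules, quotients and localizations have bounded growth as well (`HasGrowth.of_injective`,
  `HasGrowth.of_surjective`, `HasGrowth.localization`).
* Chains of submodules with `R ⧸ q`-torsion-free quotients are stationary
  (`HasGrowth.wellFounded`). Indeed the `(t + 1) ^ (2 n)` operators `x ^ a ∂_b` with exponents at
  most `t` are independent on every nonzero subquotient (`operators_independent`), hence the
  product of the ranks of two filtration steps with index `O(t)` is at least `(t + 1) ^ (2 n)`, and
  each subquotient takes a share of order `t ^ n` of a total rank of order `t ^ n`.
* Hence there are finitely many associated primes over `q` (`HasGrowth.finite_associatedPrimes`):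
  the elements killed, up to a factor outside `q`, by a power of a maximal such prime `P` form a
  submodule over the ring of operators (`powTorsionSubmodule`), and passing to the quotient by it
  removes only the prime `P`.

The class `Hol` of extensions of modules of bounded growth and of modules killed by some element
outside `q` has the same closure and finiteness properties. The modules to which the argument is
applied are those for which the kernel and the cokernel of `τ` are in `Hol` (`HolModulo`). This
holds for `S`, because a finite `R`-module killed by `τ` has a filtration with factors `R ⧸ p`, where
`p = q` or `p` contains an element outside `q` (`holModulo_polynomial`), and it passes from `M` to
the cokernel `Q` of `M → ∏ M_{f_j}`, where `J = (f_1, …, f_r)` (`HolModulo.quotient_range`).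
As the product of localizations has no local cohomology and the kernel of the map is `J`-power
torsion, the associated primes of `H^{i+1}_J(M)` are among those of `H^i_J(Q)`
(`LocalCohomologyElements.isAssociatedPrime_of_succ`). So the claim reduces to `H^0_J(M) ⊆ M`, where
the associated primes that contain `τ` are associated primes of the kernel of `τ`.
-/

/-! ### Comparison of the two definitions of `Ext` -/

open CategoryTheory

noncomputable section

namespace ExtComparison

variable {S : Type u} [CommRing S] {X X' Y : ModuleCat.{u} S}

/-- The contravariant functor `Hom(-, Y)`, with values in the opposite of the category of
modules. -/
abbrev homInto (Y : ModuleCat.{u} S) : ModuleCat.{u} S ⥤ (ModuleCat.{u} S)ᵒᵖ :=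
  ((linearYoneda S (ModuleCat.{u} S)).obj Y).rightOp

/-- The complex `Hom(P, Y)` attached to a projective resolution `P`, in the opposite category. -/
abbrev homComplex (P : ProjectiveResolution X) (Y : ModuleCat.{u} S) :
    ChainComplex (ModuleCat.{u} S)ᵒᵖ ℕ :=
  ((homInto Y).mapHomologicalComplex _).obj P.complex

/-- The module of `n`-cocycles of `Hom(P, Y)`. -/
abbrev cocycles (P : ProjectiveResolution X) (Y : ModuleCat.{u} S) (n : ℕ) : ModuleCat.{u} S :=
  ((homComplex P Y).opcycles n).unop

/-- An `n`-cocycle of `Hom(P, Y)` as a morphism `P_n ⟶ Y`. -/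
def cocycles.val (P : ProjectiveResolution X) (Y : ModuleCat.{u} S) (n : ℕ) :
    cocycles P Y n →ₗ[S] (P.complex.X n ⟶ Y) :=
  ((homComplex P Y).pOpcycles n).unop.hom

/-- The value of the functor `Ext` as the homology of `Hom(P, Y)`, in the opposite category. -/
def derivedIso (P : ProjectiveResolution X) (Y : ModuleCat.{u} S) (n : ℕ) :
    ((homInto Y).leftDerived n).obj X ≅ (homComplex P Y).homology n :=
  P.isoLeftDerivedObj (homInto Y) n

lemma derivedIso_naturality (P : ProjectiveResolution X) (P' : ProjectiveResolution X')
    (g : X' ⟶ X) (φ : ProjectiveResolution.Hom P' P g) (n : ℕ) :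
    ((homInto Y).leftDerived n).map g ≫ (derivedIso P Y n).hom =
      (derivedIso P' Y n).hom ≫ HomologicalComplex.homologyMap
        (((homInto Y).mapHomologicalComplex (ComplexShape.down ℕ)).map φ.hom) n :=
  ProjectiveResolution.isoLeftDerivedObj_hom_naturality g P' P φ.hom
      (by simpa using φ.hom_f_zero_comp_π_f_zero) (homInto Y) n

/-- The class of a cocycle in the value of the functor `Ext`. -/
def cocycles.cls (P : ProjectiveResolution X) (Y : ModuleCat.{u} S) (n : ℕ) :
    cocycles P Y n →ₗ[S] ((Ext S (ModuleCat.{u} S) n).obj (Opposite.op X)).obj Y :=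
  ((derivedIso P Y n).hom ≫ (homComplex P Y).homologyι n).unop.hom

lemma cocycles.val_injective (P : ProjectiveResolution X) (n : ℕ) :
    Function.Injective (cocycles.val P Y n) :=
  (ModuleCat.mono_iff_injective _).1 (inferInstance : Mono ((homComplex P Y).pOpcycles n).unop)

lemma cocycles.d_comp_val (P : ProjectiveResolution X) (n : ℕ) (z : cocycles P Y n) :
    P.complex.d (n + 1) n ≫ cocycles.val P Y n z = 0 := by
  have h := congrArg Quiver.Hom.unop ((homComplex P Y).d_pOpcycles (n + 1) n)
  exact congrArg (fun f => f.hom z) h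

lemma cocycles.exists_val_eq (P : ProjectiveResolution X) (n : ℕ) (f : P.complex.X n ⟶ Y)
    (hf : P.complex.d (n + 1) n ≫ f = 0) : ∃ z, cocycles.val P Y n z = f := by
  have h := (homComplex P Y).opcyclesIsCokernel (n + 1) n (by simp)
  have h2 := (ShortComplex.exact_of_g_is_cokernel (ShortComplex.mk _ _
    ((homComplex P Y).d_pOpcycles (n + 1) n)) h).unop
  exact (ShortComplex.moduleCat_exact_iff _).1 h2 f hf

lemma cocycles.cls_surjective (P : ProjectiveResolution X) (n : ℕ) :
    Function.Surjective (cocycles.cls P Y n) :=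
  (ModuleCat.epi_iff_surjective _).1 (inferInstance : Epi
    ((derivedIso P Y n).hom ≫ (homComplex P Y).homologyι n).unop)

lemma cocycles.cls_eq_zero_iff (P : ProjectiveResolution X) (n : ℕ) (z : cocycles P Y n) :
    cocycles.cls P Y n z = 0 ↔
      ∃ g : ((homComplex P Y).X ((ComplexShape.down ℕ).next n)).unop,
        ((homComplex P Y).fromOpcycles n ((ComplexShape.down ℕ).next n)).unop.hom g = z := by
  have h := (homComplex P Y).homologyIsKernel n _ rfl
  have h2 := (ShortComplex.exact_of_f_is_kernel (ShortComplex.mk _ _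
    ((homComplex P Y).homologyι_comp_fromOpcycles n _)) h).unop
  have h3 : cocycles.cls P Y n z = 0 ↔ ((homComplex P Y).homologyι n).unop.hom z = 0 := by
    have : Function.Injective (derivedIso P Y n).hom.unop.hom :=
      (ModuleCat.mono_iff_injective _).1 inferInstance
    exact map_eq_zero_iff (derivedIso P Y n).hom.unop.hom this
  rw [h3]
  constructor
  · exact (ShortComplex.moduleCat_exact_iff _).1 h2 z
  · rintro ⟨g, rfl⟩
    have := congrArg Quiver.Hom.unop
      ((homComplex P Y).homologyι_comp_fromOpcycles n ((ComplexShape.down ℕ).next n))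
    exact congrArg (fun f => f.hom g) this

lemma cocycles.cls_zero_iff (P : ProjectiveResolution X) (z : cocycles P Y 0) :
    cocycles.cls P Y 0 z = 0 ↔ z = 0 := by
  rw [cocycles.cls_eq_zero_iff, (homComplex P Y).fromOpcycles_eq_zero (by simp)]
  constructor
  · rintro ⟨g, rfl⟩; rfl
  · rintro rfl; exact ⟨0, map_zero _⟩

lemma cocycles.cls_succ_iff (P : ProjectiveResolution X) (n : ℕ) (z : cocycles P Y (n + 1)) :
    cocycles.cls P Y (n + 1) z = 0 ↔
      ∃ g : P.complex.X n ⟶ Y, P.complex.d (n + 1) n ≫ g = cocycles.val P Y (n + 1) z := by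
  rw [cocycles.cls_eq_zero_iff, show (ComplexShape.down ℕ).next (n + 1) = n by simp]
  have key : ∀ g : P.complex.X n ⟶ Y, cocycles.val P Y (n + 1)
      (((homComplex P Y).fromOpcycles (n + 1) n).unop.hom g) = P.complex.d (n + 1) n ≫ g := by
    intro g
    have := congrArg Quiver.Hom.unop ((homComplex P Y).p_fromOpcycles (n + 1) n)
    exact congrArg (fun f => f.hom g) this
  constructor
  · rintro ⟨g, rfl⟩; exact ⟨g, (key g).symm⟩
  · rintro ⟨g, hg⟩
    exact ⟨g, cocycles.val_injective P _ ((key g).trans hg)⟩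

/-- Pullback of cocycles along a lift of a morphism to projective resolutions is compatible with
the functoriality of `Ext`. -/
lemma cocycles.exists_pullback (P : ProjectiveResolution X) (P' : ProjectiveResolution X')
    (g : X' ⟶ X) (φ : ProjectiveResolution.Hom P' P g) (n : ℕ) (z : cocycles P Y n) :
    ∃ z' : cocycles P' Y n, cocycles.val P' Y n z' = φ.hom.f n ≫ cocycles.val P Y n z ∧
      cocycles.cls P' Y n z' =
        ((Ext S (ModuleCat.{u} S) n).map g.op).app Y (cocycles.cls P Y n z) := by
  let ψ := ((homInto Y).mapHomologicalComplex (ComplexShape.down ℕ)).map φ.hom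
  refine ⟨(HomologicalComplex.opcyclesMap ψ n).unop.hom z, ?_, ?_⟩
  · have := congrArg Quiver.Hom.unop (HomologicalComplex.p_opcyclesMap ψ n)
    exact congrArg (fun f => f.hom z) this
  · have h3 : ((homInto Y).leftDerived n).map g ≫
        ((derivedIso P Y n).hom ≫ (homComplex P Y).homologyι n) =
        ((derivedIso P' Y n).hom ≫ (homComplex P' Y).homologyι n) ≫
          HomologicalComplex.opcyclesMap ψ n := by
      rw [← Category.assoc, derivedIso_naturality P P' g φ n, Category.assoc, Category.assoc,
        ← HomologicalComplex.homologyι_naturality ψ n]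
    have h4 := congrArg Quiver.Hom.unop h3
    exact congrArg (fun f => f.hom z) h4.symm

/-- The class of a cocycle in `CategoryTheory.Abelian.Ext`. -/
def cocycles.ext (P : ProjectiveResolution X) (Y : ModuleCat.{u} S) (n : ℕ) :
    cocycles P Y n →ₗ[S] Abelian.Ext X Y n where
  toFun z := P.extMk (cocycles.val P Y n z) (n + 1) rfl (cocycles.d_comp_val P n z)
  map_add' z w := by
    simp only [map_add]
    rw [← P.add_extMk]
  map_smul' s z := by
    rw [Abelian.Ext.smul_eq_comp_mk₀, RingHom.id_apply, P.extMk_comp_mk₀]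
    congr 1
    rw [map_smul, Linear.comp_smul, Category.comp_id]

lemma cocycles.ext_surjective (P : ProjectiveResolution X) (n : ℕ) :
    Function.Surjective (cocycles.ext P Y n) := by
  intro α
  obtain ⟨f, hf, rfl⟩ := P.extMk_surjective α (n + 1) rfl
  obtain ⟨z, rfl⟩ := cocycles.exists_val_eq P n f hf
  exact ⟨z, rfl⟩

lemma cocycles.ext_eq_zero_iff (P : ProjectiveResolution X) (n : ℕ) (z : cocycles P Y n) :
    cocycles.ext P Y n z = 0 ↔ cocycles.cls P Y n z = 0 := by
  cases n with
  | succ n =>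
    rw [cocycles.cls_succ_iff]
    exact P.extMk_eq_zero_iff _ _ rfl (cocycles.d_comp_val P (n + 1) z) n rfl
  | zero =>
    rw [cocycles.cls_zero_iff, ← map_eq_zero_iff _ (cocycles.val_injective P 0)]
    constructor
    · intro h
      change P.extMk _ _ rfl (cocycles.d_comp_val P 0 z) = 0 at h
      rw [← P.extEquivCohomologyClass.apply_eq_iff_eq,
        P.extEquivCohomologyClass_extMk, P.extEquivCohomologyClass_zero,
        CochainComplex.HomComplex.CohomologyClass.mk_eq_zero_iff,
        CochainComplex.HomComplex.Cocycle.toSingleMk_mem_coboundaries_iff _ _ _ _ _ 1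
          (by simp)] at h
      obtain ⟨g, hg⟩ := h
      -- The cochain complex of the resolution vanishes in degree `1`.
      have h0 : g = 0 :=
        (CochainComplex.isZero_of_isStrictlyLE P.cochainComplex 0 1).eq_of_src _ _
      rw [h0, Limits.comp_zero] at hg
      rw [← cancel_epi (P.cochainComplexXIso (-(0 : ℕ)) 0 rfl).hom, ← hg, Limits.comp_zero]
    · intro h
      have : z = 0 := cocycles.val_injective P 0 (h.trans (map_zero _).symm)
      rw [this, map_zero]

/-- The comparison of the two definitions of `Ext`. -/
theorem exists_equiv (X Y : ModuleCat.{u} S) (n : ℕ) (P : ProjectiveResolution X) :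
    ∃ e : ((Ext S (ModuleCat.{u} S) n).obj (Opposite.op X)).obj Y ≃ₗ[S] Abelian.Ext X Y n,
      ∀ z, e (cocycles.cls P Y n z) = cocycles.ext P Y n z := by
  have hk : LinearMap.ker (cocycles.cls P Y n) = LinearMap.ker (cocycles.ext P Y n) := by
    ext z
    simp only [LinearMap.mem_ker, cocycles.ext_eq_zero_iff]
  let e1 := (cocycles.cls P Y n).quotKerEquivOfSurjective (cocycles.cls_surjective P n)
  let e2 := (cocycles.ext P Y n).quotKerEquivOfSurjective (cocycles.ext_surjective P n)
  refine ⟨e1.symm ≪≫ₗ Submodule.quotEquivOfEq _ _ hk ≪≫ₗ e2, fun z => ?_⟩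
  have : e1.symm (cocycles.cls P Y n z) = Submodule.Quotient.mk z :=
    e1.symm_apply_eq.2 rfl
  simp only [LinearEquiv.trans_apply, this]
  rfl

/-- The comparison isomorphism between the two definitions of `Ext`. -/
def extEquiv (X Y : ModuleCat.{u} S) (n : ℕ) :
    ((Ext S (ModuleCat.{u} S) n).obj (Opposite.op X)).obj Y ≃ₗ[S] Abelian.Ext X Y n :=
  (exists_equiv X Y n (projectiveResolution X)).choose

lemma extEquiv_cls (n : ℕ) (z : cocycles (projectiveResolution X) Y n) :
    extEquiv X Y n (cocycles.cls _ Y n z) = cocycles.ext _ Y n z :=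
  (exists_equiv X Y n (projectiveResolution X)).choose_spec z

lemma extEquiv_map (g : X' ⟶ X) (n : ℕ)
    (x : ((Ext S (ModuleCat.{u} S) n).obj (Opposite.op X)).obj Y) :
    extEquiv X' Y n (((Ext S (ModuleCat.{u} S) n).map g.op).app Y x) =
      (Abelian.Ext.mk₀ g).comp (extEquiv X Y n x) (zero_add n) := by
  obtain ⟨z, rfl⟩ := cocycles.cls_surjective (projectiveResolution X) n x
  let φ : ProjectiveResolution.Hom (projectiveResolution X') (projectiveResolution X) g :=
    { hom := ProjectiveResolution.lift g _ _
      hom_f_zero_comp_π_f_zero :=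
        ProjectiveResolution.lift_commutes_zero g _ _ }
  obtain ⟨z', h1, h2⟩ := cocycles.exists_pullback _ _ g φ n z
  rw [← h2, extEquiv_cls, extEquiv_cls]
  have := ProjectiveResolution.mk₀_comp_extMk (R := projectiveResolution X)
    (cocycles.val _ Y n z) (n + 1) rfl (cocycles.d_comp_val _ n z) φ
  refine Eq.trans ?_ this.symm
  simp only [← h1]
  rfl

end ExtComparison

end

/-! ### Elements of local cohomology -/

open CategoryTheory

noncomputable section

namespace LocalCohomologyElements

variable {S : Type u} [CommRing S] (J : Ideal S)

/-- The quotient of `S` by a power of `J`, as it occurs in the definition of local cohomology. -/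
abbrev quot (t : ℕ) : ModuleCat.{u} S :=
  (localCohomology.ringModIdeals (localCohomology.idealPowersDiagram J)).obj (Opposite.op t)

/-- The projection `S ⧸ J ^ t ⟶ S ⧸ J ^ s` for `s ≤ t`. -/
abbrev proj {s t : ℕ} (h : s ≤ t) : quot J t ⟶ quot J s :=
  (localCohomology.ringModIdeals (localCohomology.idealPowersDiagram J)).map (homOfLE h).op

lemma proj_comp {s t r : ℕ} (h : s ≤ t) (h' : t ≤ r) :
    proj J h' ≫ proj J h = proj J (h.trans h') :=
  ((localCohomology.ringModIdeals (localCohomology.idealPowersDiagram J)).map_comp _ _).symm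

instance : Limits.PreservesColimitsOfShape (ℕᵒᵖ)ᵒᵖ (forget (ModuleCat.{u} S)) :=
  have := Limits.preservesFilteredColimitsOfSize_shrink.{0, u, 0, u} (forget (ModuleCat.{u} S))
  Limits.PreservesFilteredColimitsOfSize.preserves_filtered_colimits _

variable (i : ℕ) (M : ModuleCat.{u} S)

/-- Restriction of an extension class from `S ⧸ J ^ s` to `S ⧸ J ^ t`. -/
abbrev res {J : Ideal S} {i : ℕ} {M : ModuleCat.{u} S} {s t : ℕ} (h : s ≤ t)
    (ξ : Abelian.Ext (quot J s) M i) : Abelian.Ext (quot J t) M i :=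
  (Abelian.Ext.mk₀ (proj J h)).comp ξ (zero_add i)

/-- The canonical map from `Ext` of `S ⧸ J ^ t` to local cohomology. -/
def toLC (t : ℕ) : Abelian.Ext (quot J t) M i →ₗ[S] (localCohomology J i).obj M :=
  ((Limits.colimit.ι (localCohomology.diagram (localCohomology.idealPowersDiagram J) i)
    (Opposite.op (Opposite.op t))).app M).hom ∘ₗ
      (ExtComparison.extEquiv (quot J t) M i).symm.toLinearMap

lemma toLC_apply_extEquiv (t : ℕ) (x) :
    toLC J i M t (ExtComparison.extEquiv (quot J t) M i x) =
      ((Limits.colimit.ι (localCohomology.diagram (localCohomology.idealPowersDiagram J) i)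
    (Opposite.op (Opposite.op t))).app M).hom x :=
  congrArg ((Limits.colimit.ι (localCohomology.diagram (localCohomology.idealPowersDiagram J) i)
    (Opposite.op (Opposite.op t))).app M).hom
      ((ExtComparison.extEquiv (quot J t) M i).symm_apply_apply x)

lemma toLC_surjective (h : (localCohomology J i).obj M) : ∃ t ξ, toLC J i M t ξ = h := by
  let D := localCohomology.diagram (localCohomology.idealPowersDiagram J) i
  let e := Limits.colimitObjIsoColimitCompEvaluation D M
  obtain ⟨t, y, hy⟩ := Limits.Concrete.colimit_exists_rep (D ⋙ (evaluation _ _).obj M)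
    (e.hom.hom h)
  refine ⟨t.unop.unop, ExtComparison.extEquiv _ M i y, ?_⟩
  refine (toLC_apply_extEquiv J i M t.unop.unop y).trans ?_
  have h1 := Limits.colimitObjIsoColimitCompEvaluation_ι_inv D t M
  have h2 := congrArg (fun f => f.hom y) h1
  refine h2.symm.trans ?_
  change e.inv.hom ((Limits.colimit.ι (D ⋙ (evaluation _ _).obj M) t).hom y) = h
  rw [show (Limits.colimit.ι (D ⋙ (evaluation _ _).obj M) t).hom y = e.hom.hom h from hy]
  exact congrArg (fun f => f.hom h) e.hom_inv_id

lemma toLC_res {s t : ℕ} (h : s ≤ t) (ξ : Abelian.Ext (quot J s) M i) :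
    toLC J i M t (res h ξ) = toLC J i M s ξ := by
  obtain ⟨x, rfl⟩ := (ExtComparison.extEquiv (quot J s) M i).surjective ξ
  rw [res, ← ExtComparison.extEquiv_map, toLC_apply_extEquiv, toLC_apply_extEquiv]
  let D := localCohomology.diagram (localCohomology.idealPowersDiagram J) i
  have := Limits.colimit.w D (homOfLE h).op.op
  exact congrArg (fun f => (f.app M).hom x) this

lemma exists_res_eq_zero {t : ℕ} (ξ : Abelian.Ext (quot J t) M i) (h : toLC J i M t ξ = 0) :
    ∃ (s : ℕ) (hs : t ≤ s), res hs ξ = 0 := by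
  obtain ⟨x, rfl⟩ := (ExtComparison.extEquiv (quot J t) M i).surjective ξ
  rw [toLC_apply_extEquiv] at h
  let D := localCohomology.diagram (localCohomology.idealPowersDiagram J) i
  let e := Limits.colimitObjIsoColimitCompEvaluation D M
  have h1 := Limits.colimitObjIsoColimitCompEvaluation_ι_app_hom D
    (Opposite.op (Opposite.op t)) M
  have h2 := congrArg (fun f => f.hom x) h1
  have h3 : (Limits.colimit.ι (D ⋙ (evaluation _ _).obj M)
      (Opposite.op (Opposite.op t))).hom x = 0 := by
    refine h2.symm.trans ?_
    change e.hom.hom (((Limits.colimit.ι D (Opposite.op (Opposite.op t))).app M).hom x) = 0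
    rw [show ((Limits.colimit.ι D (Opposite.op (Opposite.op t))).app M).hom x = 0 from h, map_zero]
  obtain ⟨s, a, ha⟩ := Limits.Concrete.colimit_rep_eq_zero S _ _ _ h3
  have hts : t ≤ s.unop.unop := leOfHom a.unop.unop
  refine ⟨s.unop.unop, hts, ?_⟩
  rw [res, ← ExtComparison.extEquiv_map]
  refine (LinearEquiv.map_eq_zero_iff _).2 ?_
  exact ha

lemma res_res {s t r : ℕ} (h : s ≤ t) (h' : t ≤ r) (ξ : Abelian.Ext (quot J s) M i) :
    res h' (res h ξ) = res (h.trans h') ξ := by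
  rw [res, res, res, Abelian.Ext.mk₀_comp_mk₀_assoc, proj_comp]

lemma toLC_eq_zero_iff {t : ℕ} (ξ : Abelian.Ext (quot J t) M i) :
    toLC J i M t ξ = 0 ↔ ∃ (s : ℕ) (hs : t ≤ s), res hs ξ = 0 := by
  refine ⟨exists_res_eq_zero J i M ξ, ?_⟩
  rintro ⟨s, hs, h⟩
  rw [← toLC_res J i M hs, h, map_zero]

end LocalCohomologyElements
end

/-! ### Dimension shifting for local cohomology -/

open CategoryTheory

noncomputable section

namespace LocalCohomologyElements

variable {S : Type u} [CommRing S] {J : Ideal S}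

lemma Ext.smul_eq_zero {X Y : ModuleCat.{u} S} {i : ℕ} (ξ : Abelian.Ext X Y i) {r : S}
    (hr : r • 𝟙 X = 0) : r • ξ = 0 := by
  have : ξ = (Abelian.Ext.mk₀ (𝟙 X)).comp ξ (zero_add i) := by simp
  rw [this, ← Abelian.Ext.smul_comp, ← Abelian.Ext.mk₀_smul, hr]
  simp

variable (J) in
/-- The generator of `S ⧸ J ^ t`. -/
def gen (t : ℕ) : quot J t := Submodule.Quotient.mk (1 : S)

lemma exists_smul_gen {t : ℕ} (x : quot J t) : ∃ r : S, r • gen J t = x := by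
  obtain ⟨r, rfl⟩ := Ideal.Quotient.mk_surjective x
  refine ⟨r, ?_⟩
  change r • (Ideal.Quotient.mk (J ^ t) 1) = Ideal.Quotient.mk (J ^ t) r
  rw [← Ideal.Quotient.mk_eq_mk, ← Submodule.Quotient.mk_smul, smul_eq_mul, mul_one,
    Ideal.Quotient.mk_eq_mk]

lemma smul_id_quot_eq_zero {t : ℕ} {r : S} (hr : r ∈ J ^ t) : r • 𝟙 (quot J t) = 0 := by
  ext x
  obtain ⟨x, rfl⟩ := Ideal.Quotient.mk_surjective x
  change r • (Ideal.Quotient.mk (J ^ t) x) = 0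
  rw [← Ideal.Quotient.mk_eq_mk, ← Submodule.Quotient.mk_smul, Ideal.Quotient.mk_eq_mk,
    Ideal.Quotient.eq_zero_iff_mem]
  exact Ideal.mul_mem_right _ _ hr

/-- If the identity of `E` is an `S`-linear combination of endomorphisms with coefficients in
`J ^ t`, then all extension groups of `S ⧸ J ^ t` by `E` vanish. -/
lemma ext_quot_eq_zero {E : ModuleCat.{u} S} {i t : ℕ} {κ : Type*} (s : Finset κ) (r : κ → S)
    (hr : ∀ k, r k ∈ J ^ t) (e : κ → (E ⟶ E)) (he : ∑ k ∈ s, r k • e k = 𝟙 E)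
    (ξ : Abelian.Ext (quot J t) E i) : ξ = 0 := by
  have : ξ = ξ.comp (Abelian.Ext.mk₀ (𝟙 E)) (add_zero i) := by simp
  rw [this, ← he, ← Abelian.Ext.addEquiv₀_symm_apply, map_sum]
  have hc := map_sum
    (Abelian.Ext.bilinearCompOfLinear S (quot J t) E E i 0 i (add_zero i) ξ)
    (fun k => Abelian.Ext.addEquiv₀.symm (r k • e k)) s
  refine hc.trans (Finset.sum_eq_zero fun k _ => ?_)
  rw [Abelian.Ext.addEquiv₀_symm_apply, Abelian.Ext.mk₀_smul, map_smul]
  exact Ext.smul_eq_zero _ (smul_id_quot_eq_zero (hr k))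

/-- Every element is killed by a power of `J`. -/
def IsPowTorsion (J : Ideal S) (T : Type*) [AddCommGroup T] [Module S T] : Prop :=
  ∀ x : T, ∃ t : ℕ, ∀ r ∈ J ^ t, r • x = 0

/-- The submodule of elements killed by a power of `J`. -/
def powTorsion (J : Ideal S) (I : Type*) [AddCommGroup I] [Module S I] : Submodule S I where
  carrier := {x | ∃ t : ℕ, ∀ r ∈ J ^ t, r • x = 0}
  zero_mem' := ⟨0, by simp⟩
  add_mem' := by
    rintro x y ⟨a, ha⟩ ⟨b, hb⟩
    refine ⟨max a b, fun r hr => ?_⟩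
    rw [smul_add, ha r (Ideal.pow_le_pow_right (le_max_left a b) hr),
      hb r (Ideal.pow_le_pow_right (le_max_right a b) hr), add_zero]
  smul_mem' := by
    rintro s x ⟨a, ha⟩
    exact ⟨a, fun r hr => by rw [smul_comm, ha r hr, smul_zero]⟩

lemma exists_pow_smul_eq_zero_of_fg {N : Type*} [AddCommGroup N] [Module S N]
    (hN : IsPowTorsion J N) [Module.Finite S N] : ∃ t : ℕ, ∀ r ∈ J ^ t, ∀ x : N, r • x = 0 := by
  choose t ht using hN
  obtain ⟨s, hs⟩ := (Module.Finite.fg_top : (⊤ : Submodule S N).FG)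
  refine ⟨s.sup t, fun r hr x => ?_⟩
  have : x ∈ Submodule.span S (s : Set N) := hs ▸ Submodule.mem_top
  induction this using Submodule.span_induction with
  | mem y hy => exact ht y r (Ideal.pow_le_pow_right (Finset.le_sup hy) hr)
  | zero => exact smul_zero r
  | add y z _ _ hy hz => rw [smul_add, hy, hz, add_zero]
  | smul a y _ hy => rw [smul_comm, hy, smul_zero]

/-- Over a Noetherian ring the `J`-power torsion submodule of an injective module is injective, by
Baer's criterion and the Artin-Rees lemma. -/
lemma injective_powTorsion [IsNoetherianRing S] (I : Type u) [AddCommGroup I] [Module S I]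
    [hI : Module.Injective S I] : Module.Injective S (powTorsion J I) := by
  refine Module.Baer.injective fun 𝔞 g => ?_
  obtain ⟨t, ht⟩ : ∃ t : ℕ, ∀ r ∈ J ^ t, ∀ x : LinearMap.range g, r • x = 0 := by
    refine exists_pow_smul_eq_zero_of_fg (N := LinearMap.range g) fun x => ?_
    obtain ⟨t, ht⟩ := x.1.2
    exact ⟨t, fun r hr => Subtype.ext (Subtype.ext (ht r hr))⟩
  obtain ⟨k, hk⟩ := J.exists_pow_inf_eq_pow_smul (M := S) 𝔞
  have hker : ∀ a : 𝔞, (a : S) ∈ J ^ (k + t) → g a = 0 := by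
    intro a ha
    have h1 : (a : S) ∈ J ^ t • (J ^ k • (⊤ : Submodule S S) ⊓ 𝔞) := by
      have := hk (k + t) (by simp)
      rw [Nat.add_sub_cancel_left] at this
      rw [← this]
      exact ⟨by simpa using ha, a.2⟩
    have h2 : (a : S) ∈ J ^ t • 𝔞 := Submodule.smul_mono le_rfl inf_le_right h1
    obtain ⟨a, ha'⟩ := a
    change a ∈ J ^ t • 𝔞 at h2
    clear h1 ha
    revert ha'
    induction h2 using Submodule.smul_induction_on' with
    | smul r hr n hn =>
      intro h
      have h3 : g ⟨r • n, h⟩ = r • g ⟨n, hn⟩ := by rw [← map_smul]; rfl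
      rw [h3]
      exact congrArg Subtype.val (ht r hr ⟨g ⟨n, hn⟩, LinearMap.mem_range_self _ _⟩)
    | add x hx y hy ihx ihy =>
      intro h
      have hx' := Submodule.smul_le_right hx
      have hy' := Submodule.smul_le_right hy
      have h3 : g ⟨x + y, h⟩ = g ⟨x, hx'⟩ + g ⟨y, hy'⟩ := by rw [← map_add]; rfl
      rw [h3, ihx, ihy, add_zero]
  let p : Submodule S 𝔞 := Submodule.comap 𝔞.subtype (J ^ (k + t))
  let f : (𝔞 ⧸ p) →ₗ[S] S ⧸ J ^ (k + t) := p.mapQ (J ^ (k + t)) 𝔞.subtype le_rfl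
  have hf : Function.Injective f := by
    rw [← LinearMap.ker_eq_bot, Submodule.ker_mapQ]
    rw [eq_bot_iff, Submodule.map_le_iff_le_comap, Submodule.comap_bot, Submodule.ker_mkQ]
  let g' : (𝔞 ⧸ p) →ₗ[S] I := p.liftQ ((powTorsion J I).subtype ∘ₗ g) fun a ha => by
    simp [hker a ha]
  obtain ⟨h, hh⟩ := hI.out f hf g'
  have hmem : h (Submodule.Quotient.mk 1) ∈ powTorsion J I := by
    refine ⟨k + t, fun r hr => ?_⟩
    rw [← map_smul, ← Submodule.Quotient.mk_smul, smul_eq_mul, mul_one,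
      (Submodule.Quotient.mk_eq_zero _).2 hr, map_zero]
  refine ⟨LinearMap.toSpanSingleton S _ ⟨_, hmem⟩, fun x hx => Subtype.ext ?_⟩
  have h4 := hh (Submodule.Quotient.mk ⟨x, hx⟩)
  refine Eq.trans ?_ h4
  change x • h (Submodule.Quotient.mk 1) = h (Submodule.Quotient.mk x)
  rw [← map_smul, ← Submodule.Quotient.mk_smul, smul_eq_mul, mul_one]

/-- A power torsion module embeds in an injective power torsion module, with a power torsion
quotient. -/
lemma exists_shortExact_injective [IsNoetherianRing S] (T : ModuleCat.{u} S)
    (hT : IsPowTorsion J T) : ∃ C : ShortComplex (ModuleCat.{u} S), C.ShortExact ∧ C.X₁ = T ∧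
      Injective C.X₂ ∧ IsPowTorsion J C.X₂ ∧ IsPowTorsion J C.X₃ := by
  let I := Injective.under T
  have : Module.Injective S I :=
    (Module.injective_iff_injective_object S I).2 (inferInstanceAs (Injective (Injective.under T)))
  let j : T →ₗ[S] powTorsion J I := (Injective.ι T).hom.codRestrict _ fun x => by
    obtain ⟨t, ht⟩ := hT x
    exact ⟨t, fun r hr => by rw [← map_smul, ht r hr, map_zero]⟩
  have hj : Function.Injective j := fun x y h =>
    (ModuleCat.mono_iff_injective (Injective.ι T)).1 inferInstance (congrArg Subtype.val h)
  have hI : IsPowTorsion J (powTorsion J I) := fun x => by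
    obtain ⟨t, ht⟩ := x.2
    exact ⟨t, fun r hr => Subtype.ext (ht r hr)⟩
  refine ⟨ModuleCat.shortComplexOfCompEqZero j (LinearMap.range j).mkQ
    (LinearMap.range_mkQ_comp j), ?_, rfl, ?_, hI, ?_⟩
  · exact
      { exact := (ShortComplex.ShortExact.moduleCat_exact_iff_function_exact _).mpr fun x => by
          simp
        mono_f := (ModuleCat.mono_iff_injective _).mpr hj
        epi_g := (ModuleCat.epi_iff_surjective _).mpr (Submodule.mkQ_surjective _) }
  · exact (Module.injective_iff_injective_object S _).1 (injective_powTorsion I)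
  · intro x
    obtain ⟨y, rfl⟩ := Submodule.mkQ_surjective _ x
    obtain ⟨t, ht⟩ := hI y
    exact ⟨t, fun r hr => by rw [← map_smul, ht r hr, map_zero]⟩

lemma res_comp {i k : ℕ} {M N : ModuleCat.{u} S} {s t : ℕ} (h : s ≤ t)
    (ξ : Abelian.Ext (quot J s) M i) {l : ℕ} (η : Abelian.Ext M N k) (hl : i + k = l) :
    res h (ξ.comp η hl) = (res h ξ).comp η hl := by
  rw [res, res, Abelian.Ext.comp_assoc _ _ _ (zero_add i) hl (by omega)]

/-- The higher local cohomology of a power torsion module vanishes. -/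
lemma exists_res_eq_zero_of_isPowTorsion [IsNoetherianRing S] (i : ℕ) :
    ∀ (T : ModuleCat.{u} S), IsPowTorsion J T → ∀ (t : ℕ) (ξ : Abelian.Ext (quot J t) T (i + 1)),
      ∃ (s : ℕ) (hs : t ≤ s), res hs ξ = 0 := by
  induction i with
  | zero =>
    intro T hT t ξ
    obtain ⟨C, hC, rfl, hI, hI2, hQ⟩ := exists_shortExact_injective T hT
    obtain ⟨η, rfl⟩ := Abelian.Ext.covariant_sequence_exact₁ _ hC ξ
      (Abelian.Ext.eq_zero_of_injective _) (zero_add 1)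
    obtain ⟨f, rfl⟩ := (Abelian.Ext.homEquiv₀).symm.surjective η
    obtain ⟨y, hy⟩ := (ModuleCat.epi_iff_surjective C.g).1 hC.epi_g
      (f.hom (gen J t))
    obtain ⟨s, hs⟩ := hI2 y
    refine ⟨max s t, le_max_right s t, ?_⟩
    let h : quot J (max s t) ⟶ C.X₂ := ModuleCat.ofHom <|
      Submodule.liftQ (J ^ (max s t)) (LinearMap.toSpanSingleton S C.X₂ y) fun r hr => by
        simpa using hs r (Ideal.pow_le_pow_right (le_max_left s t) hr)
    have hh : proj J (le_max_right s t) ≫ f = h ≫ C.g := by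
      ext x
      obtain ⟨r, rfl⟩ := exists_smul_gen x
      rw [map_smul, map_smul]
      congr 1
      change f.hom (gen J t) = C.g.hom (h.hom (gen J _))
      refine hy.symm.trans (congrArg C.g.hom ?_)
      exact (one_smul S y).symm
    rw [res_comp]
    change ((Abelian.Ext.mk₀ _).comp (Abelian.Ext.mk₀ f) _).comp _ _ = 0
    rw [Abelian.Ext.mk₀_comp_mk₀, hh, ← Abelian.Ext.mk₀_comp_mk₀,
      Abelian.Ext.comp_assoc _ _ _ (zero_add 0) (zero_add 1) (by omega), hC.comp_extClass,
      Abelian.Ext.comp_zero]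
  | succ i ih =>
    intro T hT t ξ
    obtain ⟨C, hC, rfl, hI, hI2, hQ⟩ := exists_shortExact_injective T hT
    obtain ⟨η, rfl⟩ := Abelian.Ext.covariant_sequence_exact₁ _ hC ξ
      (Abelian.Ext.eq_zero_of_injective _) rfl
    obtain ⟨s, hs, h⟩ := ih _ hQ t η
    exact ⟨s, hs, by rw [res_comp, h, Abelian.Ext.zero_comp]⟩

lemma isAssociatedPrime_iff_exists [IsNoetherianRing S] {P : Ideal S} {M : Type*} [AddCommGroup M]
    [Module S M] : IsAssociatedPrime P M ↔ P.IsPrime ∧ ∃ x : M, ∀ s, s ∈ P ↔ s • x = 0 := by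
  rw [isAssociatedPrime_iff]
  simp [SetLike.ext_iff, Submodule.mem_colon_singleton]

/-- The associated primes of the zeroth local cohomology of `M` are associated primes of `M`. -/
theorem isAssociatedPrime_of_zero [IsNoetherianRing S] (M : ModuleCat.{u} S) {P : Ideal S}
    (hP : IsAssociatedPrime P ((localCohomology J 0).obj M)) : IsAssociatedPrime P M := by
  rw [isAssociatedPrime_iff_exists] at hP ⊢
  obtain ⟨hP, x, hx⟩ := hP
  obtain ⟨t, ξ, rfl⟩ := toLC_surjective J 0 M x
  obtain ⟨f, rfl⟩ := (Abelian.Ext.linearEquiv₀ (R := S)).symm.surjective ξ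
  refine ⟨hP, f.hom (gen J t), fun s => ?_⟩
  rw [hx, ← map_smul, ← map_smul, toLC_eq_zero_iff]
  constructor
  · rintro ⟨r, hr, h⟩
    rw [Abelian.Ext.linearEquiv₀_symm_apply, res, Abelian.Ext.mk₀_comp_mk₀,
      ← Abelian.Ext.linearEquiv₀_symm_apply (R := S), LinearEquiv.map_eq_zero_iff] at h
    exact congrArg (fun g => g.hom (gen J r)) h
  · intro h
    refine ⟨t, le_rfl, ?_⟩
    have : s • f = 0 := by
      ext x
      obtain ⟨r, rfl⟩ := exists_smul_gen x
      rw [map_smul, map_smul]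
      exact congrArg (r • ·) h
    rw [this, map_zero, res, Abelian.Ext.comp_zero]

/-- Dimension shifting for the associated primes of local cohomology, along `M → E` with `J`-power
torsion kernel, cokernel `Q`, and `E` without any local cohomology. -/
theorem isAssociatedPrime_of_succ [IsNoetherianRing S] {M E Q : Type u} [AddCommGroup M]
    [AddCommGroup E] [AddCommGroup Q] [Module S M] [Module S E] [Module S Q]
    (f : M →ₗ[S] E) (g : E →ₗ[S] Q) (hfg : Function.Exact f g) (hg : Function.Surjective g)
    (hf : IsPowTorsion J (LinearMap.ker f))
    (hE : ∀ (t i : ℕ) (ξ : Abelian.Ext (quot J t) (ModuleCat.of S E) i), ξ = 0)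
    (i : ℕ) {P : Ideal S}
    (hP : IsAssociatedPrime P ((localCohomology J (i + 1)).obj (ModuleCat.of S M))) :
    IsAssociatedPrime P ((localCohomology J i).obj (ModuleCat.of S Q)) := by
  rw [isAssociatedPrime_iff_exists] at hP ⊢
  obtain ⟨hP, x, hx⟩ := hP
  obtain ⟨t, ξ, rfl⟩ := toLC_surjective J (i + 1) _ x
  let f' : M →ₗ[S] LinearMap.ker g := f.codRestrict _ fun m => (hfg _).2 ⟨m, rfl⟩
  have hf' : Function.Surjective f' := by
    rintro ⟨e, he⟩
    obtain ⟨m, rfl⟩ := (hfg _).1 he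
    exact ⟨m, rfl⟩
  have hC := LinearMap.shortExact_shortComplexKer hf'
  have hD := LinearMap.shortExact_shortComplexKer hg
  have hker : IsPowTorsion J (LinearMap.ker f') := fun y => by
    obtain ⟨t, ht⟩ := hf ⟨y.1, congrArg Subtype.val y.2⟩
    exact ⟨t, fun r hr => Subtype.ext (congrArg (fun z => z.1) (ht r hr))⟩
  let p : ModuleCat.of S M ⟶ ModuleCat.of S (LinearMap.ker g) := ModuleCat.ofHom f'
  obtain ⟨η, hη⟩ := Abelian.Ext.covariant_sequence_exact₁ _ hD
    (ξ.comp (Abelian.Ext.mk₀ p) (add_zero _)) (hE _ _ _) rfl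
  refine ⟨hP, toLC J i _ t η, fun s => ?_⟩
  rw [hx, ← map_smul, ← map_smul, toLC_eq_zero_iff, toLC_eq_zero_iff]
  have key : ∀ (r : ℕ) (hr : t ≤ r), res hr (s • η) = 0 ↔
      (res hr (s • ξ)).comp (Abelian.Ext.mk₀ p) (add_zero _) = 0 := by
    intro r hr
    rw [← res_comp, Abelian.Ext.smul_comp, ← hη, ← Abelian.Ext.smul_comp, res_comp]
    constructor
    · intro h
      rw [h, Abelian.Ext.zero_comp]
    · intro h
      obtain ⟨ζ, hζ⟩ := Abelian.Ext.covariant_sequence_exact₃ _ hD _ rfl h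
      rw [← hζ, hE _ _ ζ, Abelian.Ext.zero_comp]
  constructor
  · rintro ⟨r, hr, h⟩
    exact ⟨r, hr, (key r hr).2 (by rw [h, Abelian.Ext.zero_comp])⟩
  · rintro ⟨r, hr, h⟩
    obtain ⟨ζ, hζ⟩ := Abelian.Ext.covariant_sequence_exact₂ _ hC _ ((key r hr).1 h)
    obtain ⟨r', hr', h'⟩ := exists_res_eq_zero_of_isPowTorsion i _ hker r ζ
    refine ⟨r', hr.trans hr', ?_⟩
    rw [← res_res J (i + 1) _ hr hr', ← hζ, res_comp, h', Abelian.Ext.zero_comp]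

end LocalCohomologyElements
end

/-! ### Divided power derivatives and the ring of operators -/

open Finset

noncomputable section

namespace HasseOperators

variable {R : Type u} [CommRing R] {n : ℕ}

/-- Taylor expansion `f ↦ f(x + h)`, as a polynomial in `h` with coefficients polynomials in `x`. -/
def taylor : MvPolynomial (Fin n) R →+* MvPolynomial (Fin n) (MvPolynomial (Fin n) R) :=
  MvPolynomial.eval₂Hom (MvPolynomial.C.comp MvPolynomial.C)
    fun i => MvPolynomial.C (MvPolynomial.X i) + MvPolynomial.X i

/-- The divided power derivative `∂_b / b!` of a polynomial, the coefficient of `h ^ b` in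
`f(x + h)`. -/
def hasse (b : Fin n →₀ ℕ) (f : MvPolynomial (Fin n) R) : MvPolynomial (Fin n) R :=
  MvPolynomial.coeff b (taylor f)

lemma hasse_add (b : Fin n →₀ ℕ) (f g : MvPolynomial (Fin n) R) :
    hasse b (f + g) = hasse b f + hasse b g := by
  simp [hasse]

lemma hasse_mul (b : Fin n →₀ ℕ) (f g : MvPolynomial (Fin n) R) :
    hasse b (f * g) = ∑ p ∈ antidiagonal b, hasse p.1 f * hasse p.2 g := by
  simp [hasse, MvPolynomial.coeff_mul]

lemma hasse_zero (f : MvPolynomial (Fin n) R) : hasse 0 f = f := by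
  have : (MvPolynomial.constantCoeff.comp taylor : MvPolynomial (Fin n) R →+* _) =
      RingHom.id _ := by
    ext <;> simp [taylor]
  exact congrArg (fun φ => φ f) this

lemma hasse_C (b : Fin n →₀ ℕ) (r : R) :
    hasse b (MvPolynomial.C r) = if b = 0 then MvPolynomial.C r else 0 := by
  simp [hasse, taylor, MvPolynomial.coeff_C, eq_comm]

lemma hasse_X (b : Fin n →₀ ℕ) (i : Fin n) :
    hasse b (MvPolynomial.X i : MvPolynomial (Fin n) R) =
      (if b = 0 then MvPolynomial.X i else 0) + if b = Finsupp.single i 1 then 1 else 0 := by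
  classical
  simp [hasse, taylor, MvPolynomial.coeff_C, MvPolynomial.coeff_X, eq_comm]

lemma hasse_C_mul (b : Fin n →₀ ℕ) (r : R) (f : MvPolynomial (Fin n) R) :
    hasse b (MvPolynomial.C r * f) = MvPolynomial.C r * hasse b f := by
  simp [hasse, taylor, MvPolynomial.coeff_C_mul]

lemma hasse_mul_X (b : Fin n →₀ ℕ) (i : Fin n) (f : MvPolynomial (Fin n) R) :
    hasse b (f * MvPolynomial.X i) = hasse b f * MvPolynomial.X i +
      if b i ≠ 0 then hasse (b - Finsupp.single i 1) f else 0 := by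
  classical
  have : taylor (f * MvPolynomial.X i) = taylor f * MvPolynomial.C (MvPolynomial.X i) +
      taylor f * MvPolynomial.X i := by
    rw [map_mul, ← mul_add]
    simp [taylor]
  rw [hasse, this, MvPolynomial.coeff_add, mul_comm _ (MvPolynomial.C _),
    MvPolynomial.coeff_C_mul, MvPolynomial.coeff_mul_X']
  simp [hasse, mul_comm]

lemma hasse_eq_zero_of_notMem_support (f : MvPolynomial (Fin n) R) :
    ∀ b ∉ (taylor f).support, hasse b f = 0 := fun b hb => by
  simpa [hasse] using hb

/-- Induction on exponents, adding one variable at a time. -/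
lemma exponent_induction {p : (Fin n →₀ ℕ) → Prop} (a : Fin n →₀ ℕ) (zero : p 0)
    (add_single : ∀ a i, p a → p (a + Finsupp.single i 1)) : p a := by
  induction h : a.degree generalizing a with
  | zero =>
    rw [(Finsupp.degree_eq_zero_iff a).1 h]
    exact zero
  | succ d ih =>
    obtain ⟨i, hi⟩ : ∃ i, a i ≠ 0 := by
      by_contra! H
      rw [show a = 0 from Finsupp.ext H] at h
      simp at h
    have ha : a - Finsupp.single i 1 + Finsupp.single i 1 = a :=
      tsub_add_cancel_of_le (by simpa [Finsupp.single_le_iff, Nat.one_le_iff_ne_zero] using hi)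
    have hd : (a - Finsupp.single i 1).degree = d := by
      have h1 := congrArg Finsupp.degree ha
      rw [map_add, Finsupp.degree_single, h] at h1
      omega
    rw [← ha]
    exact add_single _ i (ih _ hd)

/-- The derivative `∂_b x ^ a` is supported in exponents bounded by `a`, vanishes unless `b ≤ a`,
and is `1` for `b = a`. -/
lemma hasse_monomial (a : Fin n →₀ ℕ) :
    (∀ b, ∀ c ∈ (hasse b (MvPolynomial.monomial a (1 : R))).support, c ≤ a) ∧
    (∀ b, ¬ b ≤ a → hasse b (MvPolynomial.monomial a (1 : R)) = 0) ∧
    hasse a (MvPolynomial.monomial a (1 : R)) = 1 := by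
  classical
  induction a using exponent_induction with
  | zero =>
    have h1 : (MvPolynomial.monomial 0 (1 : R) : MvPolynomial (Fin n) R) = MvPolynomial.C 1 := rfl
    refine ⟨fun b c hc => ?_, fun b hb => ?_, ?_⟩
    · rw [h1, hasse_C] at hc
      split_ifs at hc with h
      · have := MvPolynomial.support_monomial_subset hc
        simp_all
      · simp at hc
    · rw [h1, hasse_C, if_neg (by rintro rfl; exact hb le_rfl)]
    · rw [h1, hasse_C, if_pos rfl, MvPolynomial.C_1]
  | add_single a i ih =>
    obtain ⟨h1, h2, h3⟩ := ih
    have hX : (MvPolynomial.monomial (a + Finsupp.single i 1) (1 : R)) =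
        MvPolynomial.monomial a 1 * MvPolynomial.X i := by
      rw [MvPolynomial.X, MvPolynomial.monomial_mul, one_mul]
    have hlt : ∀ b : Fin n →₀ ℕ, b i ≠ 0 → b - Finsupp.single i 1 ≤ a →
        b ≤ a + Finsupp.single i 1 := fun b _ h => tsub_le_iff_right.1 h
    refine ⟨fun b c hc => ?_, fun b hb => ?_, ?_⟩
    · rw [hX, hasse_mul_X] at hc
      rcases Finset.mem_union.1 (MvPolynomial.support_add hc) with h | h
      · rw [MvPolynomial.support_mul_X] at h
        obtain ⟨c', hc', rfl⟩ := Finset.mem_map.1 h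
        exact add_le_add_left (h1 b c' hc') _
      · split_ifs at h
        · exact (h1 _ c h).trans (by simp)
        · simp at h
    · have hb' : ¬ b ≤ a := fun h => hb (h.trans (by simp))
      rw [hX, hasse_mul_X, h2 b hb', zero_mul, zero_add]
      split_ifs with h
      · exact h2 _ fun h' => hb (hlt b h h')
      · rfl
    · rw [hX, hasse_mul_X, h2, zero_mul, zero_add, if_pos (by simp), add_tsub_cancel_right, h3]
      intro h
      have := h i
      simp at this

/-- The defining relations of the ring of operators generated by polynomials and divided power
derivatives. -/
inductive DRel (R : Type u) [CommRing R] (n : ℕ) :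
    FreeAlgebra ℤ (MvPolynomial (Fin n) R ⊕ (Fin n →₀ ℕ)) →
      FreeAlgebra ℤ (MvPolynomial (Fin n) R ⊕ (Fin n →₀ ℕ)) → Prop
  | add (f g) : DRel R n (FreeAlgebra.ι ℤ (Sum.inl (f + g)))
      (FreeAlgebra.ι ℤ (Sum.inl f) + FreeAlgebra.ι ℤ (Sum.inl g))
  | mul (f g) : DRel R n (FreeAlgebra.ι ℤ (Sum.inl (f * g)))
      (FreeAlgebra.ι ℤ (Sum.inl f) * FreeAlgebra.ι ℤ (Sum.inl g))
  | one : DRel R n (FreeAlgebra.ι ℤ (Sum.inl 1)) 1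
  | d_zero : DRel R n (FreeAlgebra.ι ℤ (Sum.inr 0)) 1
  | leibniz (b f) : DRel R n (FreeAlgebra.ι ℤ (Sum.inr b) * FreeAlgebra.ι ℤ (Sum.inl f))
      (∑ p ∈ antidiagonal b,
        FreeAlgebra.ι ℤ (Sum.inl (hasse p.1 f)) * FreeAlgebra.ι ℤ (Sum.inr p.2))

/-- The ring generated by the polynomial ring `R[x]` and symbols `∂_b` for exponents `b`, subject
to `∂_0 = 1` and the Leibniz rule `∂_b f = ∑ ∂_c(f) ∂_d`, where `c + d = b`. The relations between
the products `∂_b ∂_c` are not imposed. -/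
def DOp (R : Type u) [CommRing R] (n : ℕ) : Type u := RingQuot (DRel R n)

namespace DOp

instance : Ring (DOp R n) := inferInstanceAs (Ring (RingQuot (DRel R n)))

/-- The polynomial `f` as an operator. -/
def poly : MvPolynomial (Fin n) R →+* DOp R n where
  toFun f := RingQuot.mkRingHom (DRel R n) (FreeAlgebra.ι ℤ (Sum.inl f))
  map_one' := (RingQuot.mkRingHom_rel DRel.one).trans (map_one _)
  map_mul' f g := (RingQuot.mkRingHom_rel (DRel.mul f g)).trans (map_mul _ _ _)
  map_zero' := by
    have := (RingQuot.mkRingHom_rel (DRel.add (R := R) (n := n) 0 0)).trans (map_add _ _ _)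
    rw [add_zero] at this
    exact (left_eq_add.1 this)
  map_add' f g := (RingQuot.mkRingHom_rel (DRel.add f g)).trans (map_add _ _ _)

/-- The operator `∂_b`. -/
def d (b : Fin n →₀ ℕ) : DOp R n :=
  RingQuot.mkRingHom (DRel R n) (FreeAlgebra.ι ℤ (Sum.inr b))

lemma d_zero : (d 0 : DOp R n) = 1 := (RingQuot.mkRingHom_rel DRel.d_zero).trans (map_one _)

lemma d_mul_poly (b : Fin n →₀ ℕ) (f : MvPolynomial (Fin n) R) :
    d b * poly f = ∑ p ∈ antidiagonal b, poly (hasse p.1 f) * d p.2 := by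
  refine (map_mul _ _ _).symm.trans ((RingQuot.mkRingHom_rel (DRel.leibniz b f)).trans ?_)
  rw [map_sum]
  simp only [map_mul]
  rfl

/-- The operators `f` and `∂_b` generate the ring. -/
lemma mem_of_generators (T : Subring (DOp R n)) (hp : ∀ f, poly f ∈ T) (hd : ∀ b, d b ∈ T)
    (x : DOp R n) : x ∈ T := by
  obtain ⟨x, rfl⟩ := RingQuot.mkRingHom_surjective (DRel R n) x
  induction x using FreeAlgebra.induction with
  | grade0 r => rw [eq_intCast, map_intCast]; exact intCast_mem T r
  | grade1 x =>
    rcases x with f | b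
    · exact hp f
    · exact hd b
  | mul a b ha hb => rw [map_mul]; exact mul_mem ha hb
  | add a b ha hb => rw [map_add]; exact add_mem ha hb

instance : Module (MvPolynomial (Fin n) R) (DOp R n) := Module.compHom _ poly

lemma smul_def (f : MvPolynomial (Fin n) R) (x : DOp R n) : f • x = poly f * x := rfl

section Construct

variable {M : Type*} [AddCommGroup M] [Module (MvPolynomial (Fin n) R) M]
  (D : (Fin n →₀ ℕ) → M →+ M) (hD0 : ∀ m, D 0 m = m)
  (hD : ∀ b (f : MvPolynomial (Fin n) R) m,
    D b (f • m) = ∑ p ∈ antidiagonal b, hasse p.1 f • D p.2 m)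

/-- The ring homomorphism to endomorphisms given by operators satisfying the Leibniz rule. -/
def toEnd : DOp R n →+* Module.End ℤ M :=
  RingQuot.lift ⟨(FreeAlgebra.lift ℤ (Sum.elim
    (fun f => (DistribSMul.toAddMonoidHom M f).toIntLinearMap)
    (fun b => (D b).toIntLinearMap))).toRingHom, by
      intro x y h
      induction h with
      | add f g => ext m; simp [add_smul]
      | mul f g => ext m; simp [mul_smul]
      | one => ext m; simp
      | d_zero => ext m; simp [hD0]
      | leibniz b f => ext m; simp [hD, LinearMap.sum_apply]⟩

lemma toEnd_poly (f : MvPolynomial (Fin n) R) (m : M) : toEnd D hD0 hD (poly f) m = f • m := by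
  refine (LinearMap.congr_fun (RingQuot.lift_mkRingHom_apply _ _ _) m).trans ?_
  simp

lemma toEnd_d (b : Fin n →₀ ℕ) (m : M) : toEnd D hD0 hD (d b) m = D b m := by
  refine (LinearMap.congr_fun (RingQuot.lift_mkRingHom_apply _ _ _) m).trans ?_
  simp

/-- The module structure over the ring of operators on an `R[x]`-module with a family of operators
satisfying the Leibniz rule. -/
@[reducible] def module : Module (DOp R n) M := Module.compHom M (toEnd D hD0 hD)

lemma module_d_smul (b : Fin n →₀ ℕ) (m : M) :
    letI := module D hD0 hD
    (d b : DOp R n) • m = D b m := toEnd_d D hD0 hD b m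

lemma module_isScalarTower :
    letI := module D hD0 hD
    IsScalarTower (MvPolynomial (Fin n) R) (DOp R n) M := by
  let := module D hD0 hD
  refine ⟨fun f x m => ?_⟩
  rw [smul_def, mul_smul]
  exact toEnd_poly D hD0 hD f _

end Construct

variable {M N : Type*} [AddCommGroup M] [Module (MvPolynomial (Fin n) R) M] [Module (DOp R n) M]
  [IsScalarTower (MvPolynomial (Fin n) R) (DOp R n) M]
  [AddCommGroup N] [Module (MvPolynomial (Fin n) R) N] [Module (DOp R n) N]
  [IsScalarTower (MvPolynomial (Fin n) R) (DOp R n) N]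

lemma poly_smul (f : MvPolynomial (Fin n) R) (m : M) : (poly f : DOp R n) • m = f • m := by
  rw [← one_smul (DOp R n) m, ← smul_assoc f (1 : DOp R n) m, smul_def, mul_one, one_smul]

omit [Module (MvPolynomial (Fin n) R) M]
  [IsScalarTower (MvPolynomial (Fin n) R) (DOp R n) M] in
lemma d_zero_smul (m : M) : (d 0 : DOp R n) • m = m := by rw [d_zero, one_smul]

lemma d_smul_smul (b : Fin n →₀ ℕ) (f : MvPolynomial (Fin n) R) (m : M) :
    (d b : DOp R n) • f • m = ∑ p ∈ antidiagonal b, hasse p.1 f • (d p.2 : DOp R n) • m := by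
  rw [← poly_smul, ← mul_smul, d_mul_poly, sum_smul]
  simp only [mul_smul, poly_smul]

lemma d_smul_C_smul (b : Fin n →₀ ℕ) (r : R) (m : M) :
    (d b : DOp R n) • (MvPolynomial.C r : MvPolynomial (Fin n) R) • m =
      (MvPolynomial.C r : MvPolynomial (Fin n) R) • (d b : DOp R n) • m := by
  rw [d_smul_smul, Finset.sum_eq_single (0, b)]
  · simp [hasse_zero]
  · rintro ⟨c, e⟩ hce hne
    rw [HasAntidiagonal.mem_antidiagonal] at hce
    have : c ≠ 0 := by
      rintro rfl
      exact hne (by simpa using hce)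
    rw [hasse_C, if_neg this, zero_smul]
  · simp

lemma d_smul_X_smul (b : Fin n →₀ ℕ) (i : Fin n) (m : M) :
    (d b : DOp R n) • (MvPolynomial.X i : MvPolynomial (Fin n) R) • m =
      (MvPolynomial.X i : MvPolynomial (Fin n) R) • (d b : DOp R n) • m +
        if b i ≠ 0 then (d (b - Finsupp.single i 1) : DOp R n) • m else 0 := by
  simp only [d_smul_smul, hasse_X, add_smul, sum_add_distrib, ite_smul, zero_smul, one_smul]
  congr 1
  · rw [Finset.sum_eq_single (0, b)]
    · simp
    · rintro ⟨c, e⟩ hce hne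
      rw [HasAntidiagonal.mem_antidiagonal] at hce
      refine if_neg ?_
      rintro rfl
      exact hne (by simpa using hce)
    · simp
  · split_ifs with h
    · have hb : Finsupp.single i 1 + (b - Finsupp.single i 1) = b :=
        add_tsub_cancel_of_le (by simpa [Finsupp.single_le_iff, Nat.one_le_iff_ne_zero] using h)
      rw [Finset.sum_eq_single (Finsupp.single i 1, b - Finsupp.single i 1)]
      · simp
      · rintro ⟨c, e⟩ hce hne
        rw [HasAntidiagonal.mem_antidiagonal] at hce
        refine if_neg ?_
        rintro rfl
        refine hne (Prod.ext rfl ?_)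
        simp [← hce]
      · intro h'
        exact absurd (HasAntidiagonal.mem_antidiagonal.2 hb) h'
    · refine Finset.sum_eq_zero ?_
      rintro ⟨c, e⟩ hce
      rw [HasAntidiagonal.mem_antidiagonal] at hce
      refine if_neg ?_
      rintro rfl
      refine h ?_
      simp [← hce]

/-- A linear map commuting with the operators `∂_b` is linear over the ring of operators. -/
def linearMap (φ : M →ₗ[MvPolynomial (Fin n) R] N)
    (hφ : ∀ b m, φ ((d b : DOp R n) • m) = (d b : DOp R n) • φ m) : M →ₗ[DOp R n] N where
  toFun := φ
  map_add' := φ.map_add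
  map_smul' x := by
    let T : Subring (DOp R n) :=
      { carrier := {x | ∀ m, φ (x • m) = x • φ m}
        mul_mem' := fun {a b} ha hb m => by rw [mul_smul, ha, hb, mul_smul]
        one_mem' := fun m => by rw [one_smul, one_smul]
        add_mem' := fun {a b} ha hb m => by rw [add_smul, map_add, ha, hb, add_smul]
        zero_mem' := fun m => by rw [zero_smul, zero_smul, map_zero]
        neg_mem' := fun {a} ha m => by rw [neg_smul, map_neg, ha, neg_smul] }
    exact mem_of_generators T (fun f m => by rw [poly_smul, poly_smul, map_smul]) hφ x

/-- A submodule over the polynomial ring which is stable under the operators `∂_b`, as a submodule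
over the ring of operators. -/
def submodule (K : Submodule (MvPolynomial (Fin n) R) M)
    (hK : ∀ b, ∀ m ∈ K, (d b : DOp R n) • m ∈ K) : Submodule (DOp R n) M where
  carrier := K
  add_mem' := K.add_mem
  zero_mem' := K.zero_mem
  smul_mem' x m hm := by
    let T : Subring (DOp R n) :=
      { carrier := {x | ∀ m ∈ K, x • m ∈ K}
        mul_mem' := fun {a b} ha hb m hm => by rw [mul_smul]; exact ha _ (hb _ hm)
        one_mem' := fun m hm => by rwa [one_smul]
        add_mem' := fun {a b} ha hb m hm => by
          rw [add_smul]; exact K.add_mem (ha _ hm) (hb _ hm)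
        zero_mem' := fun m hm => by rw [zero_smul]; exact K.zero_mem
        neg_mem' := fun {a} ha m hm => by rw [neg_smul]; exact K.neg_mem (ha _ hm) }
    exact mem_of_generators T (fun f m hm => by rw [poly_smul]; exact K.smul_mem f hm) hK x m hm

end DOp

end HasseOperators

end

/-! ### Localization of modules over the ring of operators -/

open Finset

noncomputable section

/-- Families of elements of `N` indexed by exponents, as a model of the formal power series
`N[[h]]`. -/
def PowerSeriesModule (σ N : Type*) : Type _ := (σ →₀ ℕ) → N

namespace PowerSeriesModule

variable {σ A N : Type*} [CommRing A] [AddCommGroup N] [Module A N]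

instance : AddCommGroup (PowerSeriesModule σ N) := inferInstanceAs (AddCommGroup ((σ →₀ ℕ) → N))

instance [DecidableEq σ] : SMul (MvPowerSeries σ A) (PowerSeriesModule σ N) where
  smul s y := fun b => ∑ p ∈ antidiagonal b, MvPowerSeries.coeff p.1 s • y p.2

lemma smul_apply [DecidableEq σ] (s : MvPowerSeries σ A) (y : PowerSeriesModule σ N) (b : σ →₀ ℕ) :
    (s • y) b = ∑ p ∈ antidiagonal b, MvPowerSeries.coeff p.1 s • y p.2 := rfl

lemma add_apply (x y : PowerSeriesModule σ N) (b : σ →₀ ℕ) : (x + y) b = x b + y b := rfl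

omit [AddCommGroup N] in
@[ext] lemma ext {x y : PowerSeriesModule σ N} (h : ∀ b, x b = y b) : x = y := funext h

instance [DecidableEq σ] : Module (MvPowerSeries σ A) (PowerSeriesModule σ N) where
  one_smul y := by
    ext b
    rw [smul_apply, Finset.sum_eq_single (0, b)]
    · simp
    · rintro ⟨c, e⟩ hce hne
      rw [HasAntidiagonal.mem_antidiagonal] at hce
      have : c ≠ 0 := by
        rintro rfl
        exact hne (by simpa using hce)
      simp [MvPowerSeries.coeff_one, this]
    · simp
  mul_smul s t y := by
    ext b
    simp only [smul_apply, MvPowerSeries.coeff_mul, Finset.sum_smul, Finset.smul_sum,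
      Finset.sum_sigma']
    refine Finset.sum_nbij' (fun x => ⟨(x.2.1, x.2.2 + x.1.2), (x.2.2, x.1.2)⟩)
      (fun x => ⟨(x.1.1 + x.2.1, x.2.2), (x.1.1, x.2.1)⟩) ?_ ?_ ?_ ?_ ?_ <;>
      simp +contextual [mul_smul, ← add_assoc]
    rintro a h1 h2
    rw [add_assoc, h2, h1]
  smul_zero s := by
    ext b
    exact (Finset.sum_eq_zero fun p _ => smul_zero _)
  smul_add s x y := by
    ext b
    simp only [add_apply, smul_apply, smul_add, Finset.sum_add_distrib]
  add_smul s t y := by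
    ext b
    simp only [add_apply, smul_apply, map_add, add_smul, Finset.sum_add_distrib]
  zero_smul y := by
    ext b
    rw [smul_apply]
    simp
    rfl

end PowerSeriesModule

namespace HasseOperators

variable {R : Type u} [CommRing R] {n : ℕ} (p : Submonoid (MvPolynomial (Fin n) R))
  (M : Type u) [AddCommGroup M] [Module (MvPolynomial (Fin n) R) M]

/-- Taylor expansion with values in power series over a localization. -/
def taylorLoc : MvPolynomial (Fin n) R →+* MvPowerSeries (Fin n) (Localization p) :=
  (MvPowerSeries.map (algebraMap _ (Localization p))).comp
    (MvPolynomial.coeToMvPowerSeries.ringHom.comp taylor)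

lemma coeff_taylorLoc (f : MvPolynomial (Fin n) R) (b : Fin n →₀ ℕ) :
    MvPowerSeries.coeff b (taylorLoc p f) = algebraMap _ (Localization p) (hasse b f) := by
  simp [taylorLoc, hasse]

/-- Power series in `h` with coefficients in a localization of `M`. A polynomial `f(x)` acts on it
as `f(x + h)`. -/
def Jet : Type u := PowerSeriesModule (Fin n) (LocalizedModule p M)

namespace Jet

instance : AddCommGroup (Jet p M) :=
  inferInstanceAs (AddCommGroup (PowerSeriesModule (Fin n) (LocalizedModule p M)))

instance : Module (MvPowerSeries (Fin n) (Localization p)) (Jet p M) :=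
  inferInstanceAs (Module (MvPowerSeries (Fin n) (Localization p))
    (PowerSeriesModule (Fin n) (LocalizedModule p M)))

instance : Module (MvPolynomial (Fin n) R) (Jet p M) := Module.compHom _ (taylorLoc p)

variable {p M}

variable (p M) in
/-- The coefficient of `h ^ b` of a power series. -/
def coeff (b : Fin n →₀ ℕ) : Jet p M →+ LocalizedModule p M where
  toFun y := (id y : PowerSeriesModule (Fin n) (LocalizedModule p M)) b
  map_zero' := rfl
  map_add' _ _ := rfl

/-- The power series with given coefficients. -/
def mk (y : (Fin n →₀ ℕ) → LocalizedModule p M) : Jet p M := y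

lemma coeff_mk (y : (Fin n →₀ ℕ) → LocalizedModule p M) (b : Fin n →₀ ℕ) :
    coeff p M b (mk y) = y b := rfl

@[ext] lemma ext {x y : Jet p M} (h : ∀ b, coeff p M b x = coeff p M b y) : x = y := funext h

lemma coeff_smul (f : MvPolynomial (Fin n) R) (y : Jet p M) (b : Fin n →₀ ℕ) :
    coeff p M b (f • y) = ∑ c ∈ antidiagonal b, hasse c.1 f • coeff p M c.2 y := by
  refine (PowerSeriesModule.smul_apply (taylorLoc p f)
    (id y : PowerSeriesModule (Fin n) (LocalizedModule p M)) b).trans ?_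
  refine Finset.sum_congr rfl fun c _ => ?_
  rw [coeff_taylorLoc, algebraMap_smul]
  rfl

variable (p M)

/-- Taking the constant term is linear over the polynomial ring. -/
def constantCoeff : Jet p M →ₗ[MvPolynomial (Fin n) R] LocalizedModule p M where
  toFun := coeff p M 0
  map_add' := map_add _
  map_smul' f y := by
    rw [coeff_smul]
    simp [hasse_zero]

/-- The elements of `p` act invertibly, since their Taylor series have an invertible constant
term. -/
lemma isUnit (f : p) :
    IsUnit (algebraMap (MvPolynomial (Fin n) R)
      (Module.End (MvPolynomial (Fin n) R) (Jet p M)) f) := by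
  have hu : IsUnit (taylorLoc p f.1) := by
    rw [MvPowerSeries.isUnit_iff_constantCoeff, ← MvPowerSeries.coeff_zero_eq_constantCoeff_apply,
      coeff_taylorLoc, hasse_zero]
    exact IsLocalization.map_units _ f
  rw [Module.End.isUnit_iff]
  obtain ⟨v, hv⟩ := hu
  have hf : ∀ y : Jet p M, f.1 • y = taylorLoc p f.1 • y := fun y => rfl
  constructor
  · intro x y hxy
    change f.1 • x = f.1 • y at hxy
    rw [hf, hf, ← hv] at hxy
    simpa [← mul_smul] using
      congrArg (fun z => (↑v⁻¹ : MvPowerSeries (Fin n) (Localization p)) • z) hxy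
  · intro y
    refine ⟨(↑v⁻¹ : MvPowerSeries (Fin n) (Localization p)) • y, ?_⟩
    change f.1 • ((↑v⁻¹ : MvPowerSeries (Fin n) (Localization p)) • y) = y
    rw [hf, ← hv, ← mul_smul]
    simp

end Jet

namespace DOp

variable [Module (DOp R n) M] [IsScalarTower (MvPolynomial (Fin n) R) (DOp R n) M]

/-- The Taylor expansion `m ↦ ∑ ∂_b(m) h ^ b`. -/
def taylorMap : M →ₗ[MvPolynomial (Fin n) R] Jet p M where
  toFun m := Jet.mk fun b => LocalizedModule.mk ((d b : DOp R n) • m) 1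
  map_add' x y := by
    ext b
    rw [map_add]
    simp only [Jet.coeff_mk]
    rw [smul_add, LocalizedModule.mk_add_mk]
    simp
  map_smul' f y := by
    ext b
    rw [RingHom.id_apply, Jet.coeff_smul]
    simp only [Jet.coeff_mk]
    rw [d_smul_smul]
    have h := map_sum (LocalizedModule.mkLinearMap p M)
      (fun c => hasse c.1 f • (d c.2 : DOp R n) • y) (antidiagonal b)
    simp only [map_smul] at h
    exact h

/-- The Taylor expansion on a localization. -/
def taylorLocalized : LocalizedModule p M →ₗ[MvPolynomial (Fin n) R] Jet p M :=
  LocalizedModule.lift p (taylorMap p M) (Jet.isUnit p M)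

lemma taylorLocalized_mk (m : M) (b : Fin n →₀ ℕ) :
    Jet.coeff p M b (taylorLocalized p M (LocalizedModule.mk m 1)) =
      LocalizedModule.mk ((d b : DOp R n) • m) 1 :=
  congrArg (Jet.coeff p M b)
    (LinearMap.congr_fun (LocalizedModule.lift_comp p (taylorMap p M) (Jet.isUnit p M)) m)

lemma taylorLocalized_zero (x : LocalizedModule p M) :
    Jet.coeff p M 0 (taylorLocalized p M x) = x := by
  have : Jet.constantCoeff p M ∘ₗ taylorLocalized p M = LinearMap.id := by
    refine IsLocalizedModule.linearMap_ext p (LocalizedModule.mkLinearMap p M)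
      (LocalizedModule.mkLinearMap p M) (LinearMap.ext fun m => ?_)
    change Jet.coeff p M 0 (taylorLocalized p M (LocalizedModule.mk m 1)) = LocalizedModule.mk m 1
    rw [taylorLocalized_mk, d_zero_smul]
  exact LinearMap.congr_fun this x

/-- The localization of a module over the ring of operators: the operators `∂_b` extend uniquely by
the Leibniz rule. -/
instance : Module (DOp R n) (LocalizedModule p M) :=
  module (fun b => (Jet.coeff p M b).comp (taylorLocalized p M).toAddMonoidHom)
    (taylorLocalized_zero p M)
    (fun b f x => by
      change Jet.coeff p M b (taylorLocalized p M (f • x)) = _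
      rw [map_smul, Jet.coeff_smul]
      rfl)

instance : IsScalarTower (MvPolynomial (Fin n) R) (DOp R n) (LocalizedModule p M) :=
  module_isScalarTower _ _ _

lemma d_smul_localized (b : Fin n →₀ ℕ) (x : LocalizedModule p M) :
    (d b : DOp R n) • x = Jet.coeff p M b (taylorLocalized p M x) := module_d_smul _ _ _ b x

/-- The localization map as a map of modules over the ring of operators. -/
def mkLoc : M →ₗ[DOp R n] LocalizedModule p M :=
  linearMap (LocalizedModule.mkLinearMap p M) fun b m => by
    rw [d_smul_localized]
    exact (taylorLocalized_mk p M m b).symm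

lemma mkLoc_apply (m : M) : mkLoc p M m = LocalizedModule.mk m 1 := rfl

variable {M} {N : Type u} [AddCommGroup N] [Module (MvPolynomial (Fin n) R) N]
  [Module (DOp R n) N] [IsScalarTower (MvPolynomial (Fin n) R) (DOp R n) N]

/-- The localization of a map of modules over the ring of operators. -/
def mapLoc (φ : M →ₗ[DOp R n] N) : LocalizedModule p M →ₗ[DOp R n] LocalizedModule p N :=
  linearMap (IsLocalizedModule.map p (LocalizedModule.mkLinearMap p M)
    (LocalizedModule.mkLinearMap p N) (φ.restrictScalars (MvPolynomial (Fin n) R))) fun b x => by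
    rw [d_smul_localized, d_smul_localized]
    let φ' := IsLocalizedModule.map p (LocalizedModule.mkLinearMap p M)
      (LocalizedModule.mkLinearMap p N) (φ.restrictScalars (MvPolynomial (Fin n) R))
    let F : Jet p M →ₗ[MvPolynomial (Fin n) R] Jet p N :=
      { toFun := fun y => Jet.mk fun b => φ' (Jet.coeff p M b y)
        map_add' := fun x y => by
          ext b
          simp only [map_add, Jet.coeff_mk]
        map_smul' := fun f y => by
          ext b
          rw [RingHom.id_apply, Jet.coeff_smul]
          simp only [Jet.coeff_mk]
          rw [Jet.coeff_smul, map_sum]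
          simp only [map_smul] }
    have key : F ∘ₗ taylorLocalized p M = taylorLocalized p N ∘ₗ φ' := by
      refine IsLocalizedModule.ext p (LocalizedModule.mkLinearMap p M) (Jet.isUnit p N)
        (LinearMap.ext fun m => ?_)
      ext b
      have h1 : ∀ m, φ' (LocalizedModule.mk m 1) = LocalizedModule.mk (φ m) 1 :=
        fun m => IsLocalizedModule.map_LocalizedModules p _ m 1
      change φ' (Jet.coeff p M b (taylorLocalized p M (LocalizedModule.mk m 1))) =
        Jet.coeff p N b (taylorLocalized p N (φ' (LocalizedModule.mk m 1)))
      rw [taylorLocalized_mk, h1, h1, taylorLocalized_mk, map_smul]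
    exact congrArg (Jet.coeff p N b) (LinearMap.congr_fun key x)

lemma mapLoc_mk (φ : M →ₗ[DOp R n] N) (m : M) (s : p) :
    mapLoc p φ (LocalizedModule.mk m s) = LocalizedModule.mk (φ m) s :=
  IsLocalizedModule.map_LocalizedModules p _ m s

lemma mapLoc_exact {K : Type u} [AddCommGroup K] [Module (MvPolynomial (Fin n) R) K]
    [Module (DOp R n) K] [IsScalarTower (MvPolynomial (Fin n) R) (DOp R n) K]
    (φ : M →ₗ[DOp R n] N) (ψ : N →ₗ[DOp R n] K) (h : Function.Exact φ ψ) :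
    Function.Exact (mapLoc p φ) (mapLoc p ψ) :=
  LocalizedModule.map_exact p (φ.restrictScalars (MvPolynomial (Fin n) R))
    (ψ.restrictScalars (MvPolynomial (Fin n) R)) h

end DOp

end HasseOperators
end

/-! ### Ranks modulo a prime ideal -/

open Finset

noncomputable section

namespace HasseOperators

open MvPolynomial (C X)

variable {R : Type u} [CommRing R] {n : ℕ} (q : Ideal R)
  {M : Type u} [AddCommGroup M] [Module (MvPolynomial (Fin n) R) M]

variable (n) in
/-- Independence of a finite family modulo the additive subgroup `N`, with coefficients in `R`
taken modulo the ideal `q`. -/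
def IndepMod (N : AddSubgroup M) {κ : Type*} [Fintype κ] (v : κ → M) : Prop :=
  ∀ a : κ → R, ∑ k, (C (a k) : MvPolynomial (Fin n) R) • v k ∈ N → ∀ k, a k ∈ q

variable (n) in
/-- Independent families in `V` modulo `N` have at most `B` elements. -/
def RankLE (N : AddSubgroup M) (V : Set M) (B : ℕ) : Prop :=
  ∀ (m : ℕ) (v : Fin m → M), (∀ k, v k ∈ V) → IndepMod n q N v → m ≤ B

variable (n) in
/-- Saturation of an additive subgroup: the quotient has no `R ⧸ q`-torsion. -/
def Saturated (N : AddSubgroup M) : Prop :=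
  ∀ r ∉ q, ∀ m : M, (C r : MvPolynomial (Fin n) R) • m ∈ N → m ∈ N

variable {q}

/-- More vectors than coordinates over the domain `R ⧸ q` are dependent. -/
lemma exists_relation [hq : q.IsPrime] {κ ι : Type*} [Fintype κ] [Fintype ι] (γ : κ → ι → R)
    (h : Fintype.card ι < Fintype.card κ) :
    ∃ a : κ → R, (∃ k, a k ∉ q) ∧ ∀ i, ∑ k, a k * γ k i ∈ q := by
  let g : κ → ι → R ⧸ q := fun k i => Ideal.Quotient.mk q (γ k i)
  have hg : ¬ LinearIndependent (R ⧸ q) g := fun hli => by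
    have := hli.fintype_card_le_finrank
    rw [Module.finrank_fintype_fun_eq_card] at this
    omega
  obtain ⟨a, ha, k, hk⟩ := Fintype.not_linearIndependent_iff.1 hg
  choose a' ha' using fun k => Ideal.Quotient.mk_surjective (a k)
  refine ⟨a', ⟨k, fun h => hk ?_⟩, fun i => ?_⟩
  · rw [← ha', Ideal.Quotient.eq_zero_iff_mem.2 h]
  · rw [← Ideal.Quotient.eq_zero_iff_mem, map_sum]
    have := congrFun ha i
    simpa [g, ha'] using this

lemma RankLE.of_bot {N : AddSubgroup M} {V : Set M} {B : ℕ}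
    (h : RankLE n q (⊥ : AddSubgroup M) V B) :
    RankLE n q N V B :=
  fun m v hv hi => h m v hv fun a ha => hi a (by rw [AddSubgroup.mem_bot.1 ha]; exact N.zero_mem)

/-- A maximal independent family: up to a factor outside `q`, finitely many elements of `V` are
combinations of it modulo `N`. -/
lemma exists_maximal_indep [hq : q.IsPrime]
    (hkill : ∀ r ∈ q, ∀ m : M, (C r : MvPolynomial (Fin n) R) • m = 0)
    {N : AddSubgroup M} (hN : ∀ r : R, ∀ m ∈ N, (C r : MvPolynomial (Fin n) R) • m ∈ N)
    {V : Set M} {B : ℕ} (hB : RankLE n q N V B) :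
    ∃ (m : ℕ) (v : Fin m → M), (∀ k, v k ∈ V) ∧ IndepMod n q N v ∧ m ≤ B ∧
      ∀ (ι : Type) [Fintype ι] (x : ι → M), (∀ i, x i ∈ V) → ∃ b ∉ q, ∃ β : ι → Fin m → R, ∀ i,
        (C b : MvPolynomial (Fin n) R) • x i -
          ∑ k, (C (β i k) : MvPolynomial (Fin n) R) • v k ∈ N := by
  classical
  let Q : ℕ → Prop := fun m => ∃ v : Fin m → M, (∀ k, v k ∈ V) ∧ IndepMod n q N v
  have hQ0 : Q 0 := ⟨Fin.elim0, fun k => k.elim0, fun a _ k => k.elim0⟩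
  have hQB : ∀ m, Q m → m ≤ B := fun m ⟨v, hv, hi⟩ => hB m v hv hi
  obtain ⟨m, ⟨v, hv, hi⟩, hmax⟩ : ∃ m, Q m ∧ ¬ Q (m + 1) := by
    refine ⟨Nat.findGreatest Q B, Nat.findGreatest_spec (Nat.zero_le B) hQ0, fun h => ?_⟩
    have := Nat.le_findGreatest (hQB _ h) h
    omega
  refine ⟨m, v, hv, hi, hQB m ⟨v, hv, hi⟩, fun ι _ x hx => ?_⟩
  have hone : ∀ i, ∃ b ∉ q, ∃ β : Fin m → R,
      (C b : MvPolynomial (Fin n) R) • x i -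
        ∑ k, (C (β k) : MvPolynomial (Fin n) R) • v k ∈ N := by
    intro i
    have h1 : ¬ IndepMod n q N (Fin.cons (x i) v : Fin (m + 1) → M) := fun h =>
      hmax ⟨_, fun k => by refine Fin.cases ?_ ?_ k; exacts [hx i, hv], h⟩
    unfold IndepMod at h1
    push Not at h1
    obtain ⟨a, ha, k, hk⟩ := h1
    rw [Fin.sum_univ_succ] at ha
    simp only [Fin.cons_zero, Fin.cons_succ] at ha
    refine ⟨a 0, fun h0 => ?_, fun k => - a k.succ, ?_⟩
    · rw [hkill _ h0, zero_add] at ha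
      have := hi _ ha
      revert hk
      refine Fin.cases ?_ ?_ k
      · exact fun h => h h0
      · exact fun j h => h (this j)
    · simpa [sub_eq_add_neg] using ha
  choose b hb β hβ using hone
  refine ⟨∏ i, b i, fun h => ?_, fun i k => (∏ j ∈ univ.erase i, b j) * β i k, fun i => ?_⟩
  · obtain ⟨i, _, hi⟩ := (Ideal.IsPrime.prod_mem_iff).1 h
    exact hb i hi
  · have h1 : (∏ j, b j) = (∏ j ∈ univ.erase i, b j) * b i :=
      (Finset.prod_erase_mul univ b (mem_univ i)).symm
    have h2 := hN (∏ j ∈ univ.erase i, b j) _ (hβ i)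
    rw [h1]
    simpa only [smul_sub, Finset.smul_sum, ← mul_smul, ← map_mul] using h2

/-- If operators `T_k`, which are `R`-linear and preserve `N`, map `V` to `W`, and no nontrivial
combination of them maps `V` to `N`, then their number is at most the product of the ranks of `V`
and `W`. -/
lemma card_le_rank_mul_rank [hq : q.IsPrime]
    (hkill : ∀ r ∈ q, ∀ m : M, (C r : MvPolynomial (Fin n) R) • m = 0)
    {N : AddSubgroup M} (hN : ∀ r : R, ∀ m ∈ N, (C r : MvPolynomial (Fin n) R) • m ∈ N)
    (hsat : Saturated n q N) {V W : Set M} {B s : ℕ} (hV : RankLE n q N V B)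
    (hW : RankLE n q N W s) {κ : Type} [Fintype κ] (T : κ → M →+ M)
    (hTC : ∀ k (r : R) m, T k ((C r : MvPolynomial (Fin n) R) • m) =
      (C r : MvPolynomial (Fin n) R) • T k m)
    (hTN : ∀ k, ∀ m ∈ N, T k m ∈ N) (hTV : ∀ k, ∀ m ∈ V, T k m ∈ W)
    (hT : ∀ a : κ → R, (∀ m ∈ V, ∑ k, (C (a k) : MvPolynomial (Fin n) R) • T k m ∈ N) →
      ∀ k, a k ∈ q) :
    ∃ (m : ℕ) (v : Fin m → M), (∀ k, v k ∈ V) ∧ IndepMod n q N v ∧ Fintype.card κ ≤ m * s := by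
  obtain ⟨m, v, hvV, hvi, -, hv⟩ := exists_maximal_indep hkill hN hV
  obtain ⟨s', w, hwW, hwi, hs', hw⟩ := exists_maximal_indep hkill hN hW
  refine ⟨m, v, hvV, hvi, ?_⟩
  by_contra! hlt
  obtain ⟨b, hb, γ, hγ⟩ := hw (κ × Fin m) (fun x => T x.1 (v x.2)) fun x => hTV _ _ (hvV _)
  obtain ⟨a, ⟨k, hk⟩, ha⟩ := exists_relation (q := q) (fun k (x : Fin m × Fin s') => γ (k, x.1) x.2)
    (by
      rw [Fintype.card_prod, Fintype.card_fin, Fintype.card_fin]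
      exact lt_of_le_of_lt (Nat.mul_le_mul_left m hs') hlt)
  have h1 : ∀ j, ∑ k, (C (a k) : MvPolynomial (Fin n) R) • T k (v j) ∈ N := by
    intro j
    refine hsat b hb _ ?_
    have h2 : ∑ k, (C (a k) : MvPolynomial (Fin n) R) •
        ((C b : MvPolynomial (Fin n) R) • T k (v j) -
          ∑ l, (C (γ (k, j) l) : MvPolynomial (Fin n) R) • w l) ∈ N :=
      N.sum_mem fun k _ => hN _ _ (hγ (k, j))
    have h3 : ∑ k, (C (a k) : MvPolynomial (Fin n) R) •
        ∑ l, (C (γ (k, j) l) : MvPolynomial (Fin n) R) • w l = 0 := by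
      simp only [Finset.smul_sum]
      rw [Finset.sum_comm]
      refine Finset.sum_eq_zero fun l _ => ?_
      rw [← hkill _ (ha (j, l)) (w l), map_sum, Finset.sum_smul]
      exact Finset.sum_congr rfl fun k _ => by rw [map_mul, mul_smul]
    simp only [smul_sub, Finset.sum_sub_distrib, h3, sub_zero] at h2
    rw [Finset.smul_sum]
    simpa only [smul_comm (C b : MvPolynomial (Fin n) R)] using h2
  refine hk (hT a (fun x hx => ?_) k)
  obtain ⟨b', hb', β, hβ⟩ := hv Unit (fun _ => x) fun _ => hx
  refine hsat b' hb' _ ?_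
  have h4 : ∑ k, (C (a k) : MvPolynomial (Fin n) R) • T k ((C b' : MvPolynomial (Fin n) R) • x -
      ∑ j, (C (β () j) : MvPolynomial (Fin n) R) • v j) ∈ N :=
    N.sum_mem fun k _ => hN _ _ (hTN k _ (hβ ()))
  have h5 : ∑ k, (C (a k) : MvPolynomial (Fin n) R) • T k
      (∑ j, (C (β () j) : MvPolynomial (Fin n) R) • v j) ∈ N := by
    simp only [map_sum, hTC, Finset.smul_sum]
    rw [Finset.sum_comm]
    refine N.sum_mem fun j _ => ?_
    simp only [smul_comm _ (C (β () j) : MvPolynomial (Fin n) R)]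
    rw [← Finset.smul_sum]
    exact hN _ _ (h1 j)
  have h6 := N.add_mem h4 h5
  simp only [map_sub, smul_sub, Finset.sum_sub_distrib, sub_add_cancel, hTC] at h6
  rw [Finset.smul_sum]
  simpa only [smul_comm (C b' : MvPolynomial (Fin n) R)] using h6

end HasseOperators
end

/-! ### Bernstein filtrations and independence of operators -/

open Finset

noncomputable section

namespace HasseOperators

open MvPolynomial (C X)

variable {R : Type u} [CommRing R] {n : ℕ} (q : Ideal R)
  {M : Type u} [AddCommGroup M] [Module (MvPolynomial (Fin n) R) M] [Module (DOp R n) M]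

variable (n) in
/-- A filtration compatible with the Bernstein filtration of the ring of operators, in which
multiplication by a variable has degree `1` and `∂_b` has degree `|b|`. -/
structure IsBernsteinFiltration (R : Type u) [CommRing R] {M : Type u} [AddCommGroup M]
    [Module (MvPolynomial (Fin n) R) M] [Module (DOp R n) M] (F : ℕ → AddSubgroup M) : Prop where
  mono : Monotone F
  exhaust : ∀ m, ∃ j, m ∈ F j
  C_smul : ∀ j (r : R), ∀ m ∈ F j, (C r : MvPolynomial (Fin n) R) • m ∈ F j
  X_smul : ∀ j i, ∀ m ∈ F j, (X i : MvPolynomial (Fin n) R) • m ∈ F (j + 1)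
  d_smul : ∀ j b, ∀ m ∈ F j, (DOp.d b : DOp R n) • m ∈ F (j + b.degree)

variable (n M) in
/-- A module killed by `q` with a compatible filtration whose `j`-th step has rank at most
`c (j + 1) ^ n` over `R ⧸ q`; an analogue of holonomic modules. -/
def HasGrowth : Prop :=
  (∀ r ∈ q, ∀ m : M, (C r : MvPolynomial (Fin n) R) • m = 0) ∧
    ∃ F : ℕ → AddSubgroup M, IsBernsteinFiltration n R F ∧
      ∃ c : ℕ, ∀ j, RankLE n q (⊥ : AddSubgroup M) (F j) (c * (j + 1) ^ n)

variable {q} [IsScalarTower (MvPolynomial (Fin n) R) (DOp R n) M] {F : ℕ → AddSubgroup M}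

omit [IsScalarTower (MvPolynomial (Fin n) R) (DOp R n) M] in
lemma IsBernsteinFiltration.monomial_smul (hF : IsBernsteinFiltration n R F) (a : Fin n →₀ ℕ)
    {j : ℕ} {m : M} (hm : m ∈ F j) :
    (MvPolynomial.monomial a (1 : R)) • m ∈ F (j + a.degree) := by
  induction a using exponent_induction with
  | zero =>
    rw [show MvPolynomial.monomial 0 (1 : R) = 1 from rfl, one_smul]
    simpa using hm
  | add_single a i ih =>
    have h : MvPolynomial.monomial (a + Finsupp.single i 1) (1 : R) =
        X i * MvPolynomial.monomial a 1 := by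
      rw [X, MvPolynomial.monomial_mul, one_mul, add_comm]
    rw [h, mul_smul, map_add, Finsupp.degree_single, ← add_assoc]
    exact hF.X_smul _ i _ ih

/-- An exponent with entries in a box. -/
def boxExp {t : ℕ} (e : Fin n → Fin (t + 1)) : Fin n →₀ ℕ :=
  Finsupp.equivFunOnFinite.symm fun i => (e i : ℕ)

lemma boxExp_apply {t : ℕ} (e : Fin n → Fin (t + 1)) (i : Fin n) : boxExp e i = e i := rfl

lemma boxExp_injective {t : ℕ} : Function.Injective (boxExp : (Fin n → Fin (t + 1)) → _) := by
  intro e e' h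
  ext i
  exact DFunLike.congr_fun h i

lemma degree_boxExp_le {t : ℕ} (e : Fin n → Fin (t + 1)) : (boxExp e).degree ≤ n * t := by
  rw [Finsupp.degree_eq_sum]
  refine (Finset.sum_le_card_nsmul _ _ t fun i _ => ?_).trans (by simp)
  rw [boxExp_apply]
  have := (e i).2
  omega

/-- Iterated commutators with the variables lower the order of an operator: if
`∑ f_b ∂_b` maps a step of the filtration to `N`, then `∑ f_b ∂_{b - c}` maps a smaller step to
`N`. -/
lemma sum_shift_mem (hF : IsBernsteinFiltration n R F) (N N' : Submodule (DOp R n) M) {t L : ℕ}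
    (f : (Fin n → Fin (t + 1)) → MvPolynomial (Fin n) R)
    (h : ∀ x ∈ N', x ∈ F L → ∑ b, f b • (DOp.d (boxExp b) : DOp R n) • x ∈ N) (c : Fin n →₀ ℕ) :
    ∀ l, l + c.degree ≤ L → ∀ x ∈ N', x ∈ F l →
      ∑ b with c ≤ boxExp b, f b • (DOp.d (boxExp b - c) : DOp R n) • x ∈ N := by
  classical
  induction c using exponent_induction with
  | zero =>
    intro l hl x hx hxl
    simpa using h x hx (hF.mono (by simpa using hl) hxl)
  | add_single c i ih =>
    intro l hl x hx hxl
    rw [map_add, Finsupp.degree_single] at hl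
    have hX : (X i : MvPolynomial (Fin n) R) • x ∈ N' := by
      rw [← DOp.poly_smul]; exact N'.smul_mem _ hx
    have h1 := ih (l + 1) (by omega) _ hX (hF.X_smul l i x hxl)
    have h2 : (X i : MvPolynomial (Fin n) R) •
        ∑ b with c ≤ boxExp b, f b • (DOp.d (boxExp b - c) : DOp R n) • x ∈ N := by
      rw [← DOp.poly_smul]; exact N.smul_mem _ (ih l (by omega) x hx hxl)
    have h3 := N.sub_mem h1 h2
    rw [Finset.smul_sum, ← Finset.sum_sub_distrib] at h3
    have hiff : ∀ b : Fin n → Fin (t + 1), c + Finsupp.single i 1 ≤ boxExp b ↔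
        c ≤ boxExp b ∧ (boxExp b - c) i ≠ 0 := by
      intro b
      constructor
      · intro hb
        refine ⟨le_trans (by simp) hb, ?_⟩
        have := hb i
        simp at this ⊢
        omega
      · rintro ⟨hb, hb'⟩ j
        have := hb j
        by_cases hj : j = i
        · subst hj
          simp at hb' ⊢
          omega
        · simpa [Finsupp.single_apply, Ne.symm hj] using this
    have h4 : ∑ b with c + Finsupp.single i 1 ≤ boxExp b,
        f b • (DOp.d (boxExp b - (c + Finsupp.single i 1)) : DOp R n) • x =
        ∑ b with c ≤ boxExp b, (f b • (DOp.d (boxExp b - c) : DOp R n) •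
            (X i : MvPolynomial (Fin n) R) • x -
          (X i : MvPolynomial (Fin n) R) • f b • (DOp.d (boxExp b - c) : DOp R n) • x) := by
      simp only [hiff]
      rw [← Finset.filter_filter, Finset.sum_filter]
      refine Finset.sum_congr rfl fun b _ => ?_
      rw [DOp.d_smul_X_smul, smul_add, smul_comm (X i : MvPolynomial (Fin n) R) (f b),
        add_sub_cancel_left, smul_ite, smul_zero, tsub_add_eq_tsub_tsub]
    rw [h4]
    exact h3

/-- If a polynomial maps a step of the filtration to `N`, then its derivatives map a smaller step to
`N`. -/
lemma hasse_smul_mem (hF : IsBernsteinFiltration n R F) (N N' : Submodule (DOp R n) M) {L : ℕ}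
    (f : MvPolynomial (Fin n) R) (h : ∀ x ∈ N', x ∈ F L → f • x ∈ N) (d : ℕ) :
    ∀ c : Fin n →₀ ℕ, c.degree = d → ∀ l, l + c.degree ≤ L → ∀ x ∈ N', x ∈ F l →
      hasse c f • x ∈ N := by
  induction d using Nat.strong_induction_on with
  | _ d ih =>
    rintro c rfl l hl x hx hxl
    have h1 : (DOp.d c : DOp R n) • f • x ∈ N :=
      N.smul_mem _ (h x hx (hF.mono (by omega) hxl))
    rw [DOp.d_smul_smul, ← Finset.add_sum_erase _ _ (a := (c, 0)) (by simp)] at h1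
    simp only [DOp.d_zero_smul] at h1
    refine (N.add_mem_iff_left (N.sum_mem ?_)).1 h1
    rintro ⟨c1, c2⟩ hc
    obtain ⟨hne, hc⟩ := Finset.mem_erase.1 hc
    rw [HasAntidiagonal.mem_antidiagonal] at hc
    have hdeg : c1.degree + c2.degree = c.degree := by rw [← map_add]; exact congrArg _ hc
    have hc2 : c2.degree ≠ 0 := fun h0 => hne <| by
      rw [Finsupp.degree_eq_zero_iff] at h0
      subst h0
      simpa using hc
    exact ih c1.degree (by omega) c1 rfl (l + c2.degree) (by omega) _ (N'.smul_mem _ hx)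
      (hF.d_smul l c2 x hxl)

/-- The operators `x ^ a ∂_b`, with exponents in a box, are independent modulo a saturated
submodule `N`, on any filtration step that contains enough elements outside `N`. -/
lemma operators_independent
    (hkill : ∀ r ∈ q, ∀ m : M, (C r : MvPolynomial (Fin n) R) • m = 0)
    (hF : IsBernsteinFiltration n R F) (N N' : Submodule (DOp R n) M)
    (hsat : Saturated n q N.toAddSubgroup) {i₀ t : ℕ} {y : M} (hy : y ∈ N') (hyF : y ∈ F i₀)
    (hyN : y ∉ N) (a : (Fin n → Fin (t + 1)) × (Fin n → Fin (t + 1)) → R)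
    (ha : ∀ x ∈ N', x ∈ F (i₀ + 2 * (n * t)) → ∑ k, (C (a k) : MvPolynomial (Fin n) R) •
      MvPolynomial.monomial (boxExp k.1) (1 : R) • (DOp.d (boxExp k.2) : DOp R n) • x ∈ N) :
    ∀ k, a k ∈ q := by
  classical
  by_contra! hbad
  obtain ⟨k, hk⟩ := hbad
  -- An operator coefficient of maximal order, and in it a monomial of maximal degree.
  obtain ⟨b₀, hb₀, hb₀max⟩ := Finset.exists_max_image
    (univ.filter fun b : Fin n → Fin (t + 1) => ∃ e, a (e, b) ∉ q) (fun b => (boxExp b).degree)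
    ⟨k.2, by simpa using ⟨k.1, hk⟩⟩
  obtain ⟨e, he⟩ := (Finset.mem_filter.1 hb₀).2
  obtain ⟨a₀, ha₀, ha₀max⟩ := Finset.exists_max_image
    (univ.filter fun e : Fin n → Fin (t + 1) => a (e, b₀) ∉ q) (fun e => (boxExp e).degree)
    ⟨e, by simpa using he⟩
  replace ha₀ : a (a₀, b₀) ∉ q := (Finset.mem_filter.1 ha₀).2
  let f : (Fin n → Fin (t + 1)) → MvPolynomial (Fin n) R := fun b =>
    ∑ e, C (a (e, b)) * MvPolynomial.monomial (boxExp e) (1 : R)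
  have h1 : ∀ x ∈ N', x ∈ F (i₀ + 2 * (n * t)) →
      ∑ b, f b • (DOp.d (boxExp b) : DOp R n) • x ∈ N := by
    intro x hx hxF
    have := ha x hx hxF
    rw [Fintype.sum_prod_type_right] at this
    simpa only [f, Finset.sum_smul, mul_smul] using this
  have hle : ∀ x y : Fin n →₀ ℕ, x ≤ y → y.degree ≤ x.degree → x = y := by
    intro x y hxy hd
    have h2 := congrArg Finsupp.degree (add_tsub_cancel_of_le hxy)
    rw [map_add] at h2
    have h3 : (y - x).degree = 0 := by omega
    rw [Finsupp.degree_eq_zero_iff] at h3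
    rw [← add_tsub_cancel_of_le hxy, h3, add_zero]
  have hdb := degree_boxExp_le b₀
  have hda := degree_boxExp_le a₀
  have h2 : ∀ x ∈ N', x ∈ F (i₀ + n * t) → f b₀ • x ∈ N := by
    intro x hx hxF
    have := sum_shift_mem hF N N' f h1 (boxExp b₀) (i₀ + n * t) (by omega) x hx hxF
    rw [Finset.sum_eq_single b₀] at this
    · rwa [tsub_self, DOp.d_zero_smul] at this
    · intro b hb hne
      have hb := (Finset.mem_filter.1 hb).2
      have hgood : ∀ e, a (e, b) ∈ q := by
        by_contra! hcon
        exact hne (boxExp_injective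
          (hle _ _ hb (hb₀max b (Finset.mem_filter.2 ⟨mem_univ _, hcon⟩)))).symm
      simp only [f, Finset.sum_smul, mul_smul]
      exact Finset.sum_eq_zero fun e _ => hkill _ (hgood e) _
    · intro h
      exact absurd (by simp) h
  have h3 := hasse_smul_mem hF N N' (f b₀) h2 _ (boxExp a₀) rfl i₀ (by omega) y hy hyF
  have h4 : hasse (boxExp a₀) (f b₀) • y = (C (a (a₀, b₀)) : MvPolynomial (Fin n) R) • y := by
    have hsum : hasse (boxExp a₀) (f b₀) =
        ∑ e, C (a (e, b₀)) * hasse (boxExp a₀) (MvPolynomial.monomial (boxExp e) (1 : R)) := by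
      let φ : MvPolynomial (Fin n) R →+ MvPolynomial (Fin n) R :=
        AddMonoidHom.mk' (hasse (boxExp a₀)) (hasse_add _)
      refine (map_sum φ _ _).trans (Finset.sum_congr rfl fun e _ => hasse_C_mul _ _ _)
    rw [hsum, Finset.sum_smul, Finset.sum_eq_single a₀]
    · rw [(hasse_monomial _).2.2, mul_one]
    · intro e _ hne
      by_cases hq : a (e, b₀) ∈ q
      · rw [mul_smul, hkill _ hq]
      · rw [(hasse_monomial _).2.1, mul_zero, zero_smul]
        intro hle'
        exact hne (boxExp_injective
          (hle _ _ hle' (ha₀max e (Finset.mem_filter.2 ⟨mem_univ _, hq⟩)))).symm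
    · intro h
      exact absurd (mem_univ _) h
  rw [h4] at h3
  exact hyN (hsat _ ha₀ _ h3)

end HasseOperators
end

/-! ### Chain condition and finiteness of associated primes -/

open Finset

noncomputable section

namespace HasseOperators

open MvPolynomial (C X)

variable {R : Type u} [CommRing R] {n : ℕ} {q : Ideal R}
  {M : Type u} [AddCommGroup M] [Module (MvPolynomial (Fin n) R) M]

lemma RankLE.weaken {N : AddSubgroup M} {V V' : Set M} {B B' : ℕ} (h : RankLE n q N V B)
    (hV : V' ⊆ V) (hB : B ≤ B') : RankLE n q N V' B' :=
  fun m v hv hi => (h m v (fun k => hV (hv k)) hi).trans hB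

/-- Independent families for the successive quotients of `N ≤ N'` combine. -/
lemma IndepMod.append (hkill : ∀ r ∈ q, ∀ m : M, (C r : MvPolynomial (Fin n) R) • m = 0)
    {N N' : AddSubgroup M} (hNN : N ≤ N')
    (hN' : ∀ r : R, ∀ m ∈ N', (C r : MvPolynomial (Fin n) R) • m ∈ N') {m m' : ℕ}
    {v : Fin m → M} {w : Fin m' → M} (hv : IndepMod n q N v) (hvN : ∀ k, v k ∈ N')
    (hw : IndepMod n q N' w) : IndepMod n q N (Fin.append v w) := by
  intro a ha
  rw [Fin.sum_univ_add] at ha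
  simp only [Fin.append_left, Fin.append_right] at ha
  have h1 := hw (fun k => a (Fin.natAdd m k))
    ((N'.add_mem_cancel_left (N'.sum_mem fun k _ => hN' _ _ (hvN k))).1 (hNN ha))
  rw [Finset.sum_eq_zero (s := univ (α := Fin m')) fun k _ => hkill _ (h1 k) _, add_zero] at ha
  have h2 := hv (fun k => a (Fin.castAdd m' k)) ha
  intro k
  refine Fin.addCases h2 h1 k

variable [Module (DOp R n) M] [IsScalarTower (MvPolynomial (Fin n) R) (DOp R n) M]
  {F : ℕ → AddSubgroup M}

lemma smul_mem_submodule (N : Submodule (DOp R n) M) (f : MvPolynomial (Fin n) R) {m : M}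
    (hm : m ∈ N) : f • m ∈ N := by
  rw [← DOp.poly_smul]
  exact N.smul_mem _ hm

/-- Bernstein's inequality: a nonzero subquotient has growth at least of order `n`. -/
lemma exists_indep_of_notMem [hq : q.IsPrime]
    (hkill : ∀ r ∈ q, ∀ m : M, (C r : MvPolynomial (Fin n) R) • m = 0)
    (hF : IsBernsteinFiltration n R F) {c : ℕ}
    (hc : ∀ j, RankLE n q (⊥ : AddSubgroup M) (F j) (c * (j + 1) ^ n))
    (N N' : Submodule (DOp R n) M) (hsat : Saturated n q N.toAddSubgroup) {y : M} (hy : y ∈ N')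
    (hyN : y ∉ N) {t : ℕ} (hyF : y ∈ F t) :
    ∃ (m : ℕ) (v : Fin m → M), (∀ k, v k ∈ N' ∧ v k ∈ F ((2 * n + 1) * t)) ∧
      IndepMod n q N.toAddSubgroup v ∧ (t + 1) ^ n ≤ m * (c * (4 * n + 1) ^ n) := by
  obtain ⟨m, v, hv, hi, hcard⟩ := card_le_rank_mul_rank (q := q) hkill (N := N.toAddSubgroup)
    (fun r x hx => smul_mem_submodule N _ hx) hsat
    (V := {x | x ∈ N' ∧ x ∈ F (t + 2 * (n * t))}) (W := F ((t + 2 * (n * t)) + n * t + n * t))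
    (RankLE.of_bot ((hc _).weaken (fun x hx => hx.2) le_rfl)) (RankLE.of_bot (hc _))
    (κ := (Fin n → Fin (t + 1)) × (Fin n → Fin (t + 1)))
    (fun k => (DistribSMul.toAddMonoidHom M (MvPolynomial.monomial (boxExp k.1) (1 : R))).comp
      (DistribSMul.toAddMonoidHom M (DOp.d (boxExp k.2) : DOp R n)))
    (fun k r x => by
      change MvPolynomial.monomial (boxExp k.1) (1 : R) • (DOp.d (boxExp k.2) : DOp R n) •
          (C r : MvPolynomial (Fin n) R) • x = (C r : MvPolynomial (Fin n) R) •
        MvPolynomial.monomial (boxExp k.1) (1 : R) • (DOp.d (boxExp k.2) : DOp R n) • x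
      rw [DOp.d_smul_C_smul, smul_comm])
    (fun k x hx => smul_mem_submodule N _ (N.smul_mem _ hx))
    (fun k x hx => hF.mono (Nat.add_le_add_left (degree_boxExp_le k.1) _)
      (hF.monomial_smul _ (hF.mono (Nat.add_le_add_left (degree_boxExp_le k.2) _)
        (hF.d_smul _ _ _ hx.2))))
    (fun a ha => operators_independent hkill hF N N' hsat hy hyF hyN a
      fun x hx hxF => ha x ⟨hx, hxF⟩)
  refine ⟨m, v, fun k => ⟨(hv k).1, ?_⟩, hi, ?_⟩
  · convert (hv k).2 using 2
    ring
  · have h1 : (t + 2 * (n * t)) + n * t + n * t + 1 ≤ (4 * n + 1) * (t + 1) := by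
      nlinarith [Nat.zero_le n]
    rw [Fintype.card_prod, Fintype.card_fun, Fintype.card_fin, Fintype.card_fin] at hcard
    refine Nat.le_of_mul_le_mul_right (hcard.trans ?_) (pow_pos (Nat.succ_pos t) n)
    calc _ ≤ m * (c * ((4 * n + 1) * (t + 1)) ^ n) := by gcongr
      _ = _ := by rw [mul_pow]; ring

/-- In a chain of `K` strict inclusions, each step contributes an independent family of size of
order `t ^ n`, inside one fixed step of the filtration. -/
lemma exists_indep_of_chain [hq : q.IsPrime]
    (hkill : ∀ r ∈ q, ∀ m : M, (C r : MvPolynomial (Fin n) R) • m = 0)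
    (hF : IsBernsteinFiltration n R F) {c : ℕ}
    (hc : ∀ j, RankLE n q (⊥ : AddSubgroup M) (F j) (c * (j + 1) ^ n))
    (N : ℕ → Submodule (DOp R n) M) (hN : Monotone N)
    (hsat : ∀ k, Saturated n q (N k).toAddSubgroup) {t : ℕ} (K : ℕ)
    (hK : ∀ k < K, ∃ y ∈ N (k + 1), y ∉ N k ∧ y ∈ F t) :
    ∃ (m : ℕ) (v : Fin m → M), (∀ k, v k ∈ N K ∧ v k ∈ F ((2 * n + 1) * t)) ∧
      IndepMod n q (N 0).toAddSubgroup v ∧ K * (t + 1) ^ n ≤ m * (c * (4 * n + 1) ^ n) := by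
  induction K with
  | zero => exact ⟨0, Fin.elim0, fun k => k.elim0, fun a _ k => k.elim0, by simp⟩
  | succ K ih =>
    obtain ⟨m, v, hv, hi, hle⟩ := ih fun k hk => hK k (by omega)
    obtain ⟨y, hy, hyN, hyF⟩ := hK K (by omega)
    obtain ⟨m', w, hw, hi', hle'⟩ :=
      exists_indep_of_notMem hkill hF hc (N K) (N (K + 1)) (hsat K) hy hyN hyF
    refine ⟨m + m', Fin.append v w, fun k => ?_, IndepMod.append hkill (N' := (N K).toAddSubgroup)
      (hN (Nat.zero_le K)) (fun r x hx => smul_mem_submodule _ _ hx) hi (fun k => (hv k).1) hi', ?_⟩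
    · refine Fin.addCases (fun k => ?_) (fun k => ?_) k
      · rw [Fin.append_left]
        exact ⟨hN (Nat.le_succ K) (hv k).1, (hv k).2⟩
      · rw [Fin.append_right]
        exact hw k
    · rw [add_mul, add_mul, one_mul]
      exact Nat.add_le_add hle hle'

/-- Ascending chains of saturated submodules of a module of bounded growth are stationary. -/
lemma HasGrowth.wellFounded [hq : q.IsPrime] (h : HasGrowth n q M) :
    WellFounded ((· > ·) : {N : Submodule (DOp R n) M // Saturated n q N.toAddSubgroup} →
      {N : Submodule (DOp R n) M // Saturated n q N.toAddSubgroup} → Prop) := by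
  obtain ⟨hkill, F, hF, c, hc⟩ := h
  rw [RelEmbedding.wellFounded_iff_isEmpty]
  refine ⟨fun e => ?_⟩
  -- The number `K` of steps exceeds the bound that comparison of ranks gives for large `t`.
  have hlt : ∀ k, (e k).1 < (e (k + 1)).1 := fun k => e.map_rel_iff.2 (Nat.lt_succ_self k)
  choose y hy hyN using fun k => SetLike.exists_of_lt (hlt k)
  choose i hi using fun k => hF.exhaust (y k)
  let K := (c * (2 * n + 1) ^ n) * (c * (4 * n + 1) ^ n) + 1
  let t := (range K).sup i
  obtain ⟨m, v, hv, hvi, hle⟩ := exists_indep_of_chain (t := t) hkill hF hc (fun k => (e k).1)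
    (monotone_nat_of_le_succ fun k => (hlt k).le) (fun k => (e k).2) K
    fun k hk => ⟨y k, hy k, hyN k, hF.mono (Finset.le_sup (mem_range.2 hk)) (hi k)⟩
  have h1 := (RankLE.of_bot (hc ((2 * n + 1) * t))) m v (fun k => (hv k).2) hvi
  have h2 : (2 * n + 1) * t + 1 ≤ (2 * n + 1) * (t + 1) := by nlinarith [Nat.zero_le n]
  have h3 : K * (t + 1) ^ n ≤ (K - 1) * (t + 1) ^ n := by
    refine hle.trans ?_
    calc _ ≤ (c * ((2 * n + 1) * (t + 1)) ^ n) * (c * (4 * n + 1) ^ n) := by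
          gcongr
          exact h1.trans (by gcongr)
      _ = _ := by simp only [K, Nat.add_sub_cancel]; rw [mul_pow]; ring
  have := Nat.le_of_mul_le_mul_right h3 (pow_pos (Nat.succ_pos t) n)
  omega

lemma hasse_mem_pow (I : Ideal (MvPolynomial (Fin n) R)) (l : ℕ) :
    ∀ f ∈ I ^ l, ∀ c : Fin n →₀ ℕ, hasse c f ∈ I ^ (l - c.degree) := by
  induction l with
  | zero => intro f _ c; simp
  | succ l ih =>
    intro f hf c
    rw [pow_succ] at hf
    induction hf using Submodule.mul_induction_on' with
    | mem_mul_mem f hf g hg =>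
      rw [hasse_mul]
      refine Ideal.sum_mem _ ?_
      rintro ⟨c1, c2⟩ hc
      rw [HasAntidiagonal.mem_antidiagonal] at hc
      have hdeg : c1.degree + c2.degree = c.degree := by rw [← map_add]; exact congrArg _ hc
      by_cases h : c2 = 0
      · subst h
        rw [hasse_zero]
        simp only [add_zero, map_zero] at hc hdeg
        have := Ideal.mul_mem_mul (ih f hf c1) hg
        rw [← pow_succ] at this
        exact Ideal.pow_le_pow_right (by omega) this
      · have : c2.degree ≠ 0 := fun h0 => h ((Finsupp.degree_eq_zero_iff _).1 h0)
        exact Ideal.mul_mem_right _ _ (Ideal.pow_le_pow_right (by omega) (ih f hf c1))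
    | add f _ g _ hf hg =>
      rw [hasse_add]
      exact Ideal.add_mem _ hf hg

/-- The elements which, up to a factor outside `q`, are mapped to `N` by a power of `P`. -/
def powTorsionSubmodule [hq : q.IsPrime] (N : Submodule (DOp R n) M)
    (P : Ideal (MvPolynomial (Fin n) R)) : Submodule (DOp R n) M :=
  DOp.submodule
    { carrier := {m | ∃ r ∉ q, ∃ k : ℕ, ∀ s ∈ P ^ k, (C r : MvPolynomial (Fin n) R) • s • m ∈ N}
      zero_mem' := ⟨1, fun h => hq.ne_top ((Ideal.eq_top_iff_one _).2 h), 0, fun s _ => by simp⟩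
      add_mem' := by
        rintro x y ⟨r, hr, k, h⟩ ⟨r', hr', k', h'⟩
        refine ⟨r * r', hq.mul_notMem hr hr', max k k', fun s hs => ?_⟩
        rw [smul_add, smul_add, map_mul]
        refine N.add_mem ?_ ?_
        · rw [mul_comm, mul_smul]
          exact smul_mem_submodule N _ (h s (Ideal.pow_le_pow_right (le_max_left _ _) hs))
        · rw [mul_smul]
          exact smul_mem_submodule N _ (h' s (Ideal.pow_le_pow_right (le_max_right _ _) hs))
      smul_mem' := by
        rintro f x ⟨r, hr, k, h⟩
        refine ⟨r, hr, k, fun s hs => ?_⟩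
        rw [smul_comm s f, smul_comm _ f]
        exact smul_mem_submodule N _ (h s hs) }
    (by
      rintro b m ⟨r, hr, k, h⟩
      refine ⟨r, hr, k + b.degree, ?_⟩
      induction hd : b.degree using Nat.strong_induction_on generalizing b with
      | _ d ih =>
        subst hd
        intro s hs
        have h1 : (DOp.d b : DOp R n) • (C r : MvPolynomial (Fin n) R) • s • m ∈ N :=
          N.smul_mem _ (h s (Ideal.pow_le_pow_right (by omega) hs))
        rw [DOp.d_smul_C_smul, DOp.d_smul_smul,
          ← Finset.add_sum_erase _ _ (a := (0, b)) (by simp)] at h1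
        simp only [hasse_zero] at h1
        rw [smul_add, Finset.smul_sum] at h1
        refine (N.add_mem_iff_left (N.sum_mem ?_)).1 h1
        rintro ⟨c1, c2⟩ hc
        obtain ⟨hne, hc⟩ := Finset.mem_erase.1 hc
        rw [HasAntidiagonal.mem_antidiagonal] at hc
        have hdeg : c1.degree + c2.degree = b.degree := by rw [← map_add]; exact congrArg _ hc
        have hc1 : c1.degree ≠ 0 := fun h0 => hne <| by
          rw [Finsupp.degree_eq_zero_iff] at h0
          subst h0
          simpa using hc
        refine ih c2.degree (by omega) c2 rfl _ ?_
        convert hasse_mem_pow P _ s hs c1 using 2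
        omega)

lemma saturated_powTorsionSubmodule [hq : q.IsPrime] (N : Submodule (DOp R n) M)
    (P : Ideal (MvPolynomial (Fin n) R)) :
    Saturated n q (powTorsionSubmodule (q := q) N P).toAddSubgroup := by
  rintro r₀ hr₀ m ⟨r, hr, k, h⟩
  refine ⟨r * r₀, hq.mul_notMem hr hr₀, k, fun s hs => ?_⟩
  rw [map_mul, mul_smul, smul_comm _ s]
  exact h s hs

variable (q) in
/-- The associated primes of `M ⧸ N` lying over `q`. -/
def assOver (N : Submodule (DOp R n) M) : Set (Ideal (MvPolynomial (Fin n) R)) :=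
  {P | P.IsPrime ∧ P.comap C = q ∧ ∃ x : M, ∀ s, s ∈ P ↔ s • x ∈ N}

lemma C_notMem_of_comap {P : Ideal (MvPolynomial (Fin n) R)} (h : P.comap C = q) {r : R}
    (hr : r ∉ q) : C r ∉ P := fun h' => hr (h ▸ h')

lemma finite_assOver [IsNoetherianRing R] [hq : q.IsPrime] (h : HasGrowth n q M)
    (N : {N : Submodule (DOp R n) M // Saturated n q N.toAddSubgroup}) :
    (assOver q N.1).Finite := by
  induction N using h.wellFounded.induction with
  | _ N ih =>
    obtain ⟨N, hN⟩ := N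
    change (assOver q N).Finite
    rcases (assOver q N).eq_empty_or_nonempty with he | hne
    · rw [he]; exact Set.finite_empty
    -- For `P` maximal, the other primes survive in `M ⧸ N'`, as they do not contain a power of `P`.
    obtain ⟨P, ⟨hP, hPq, x, hx⟩, hmax⟩ :=
      (wellFounded_gt (α := Ideal (MvPolynomial (Fin n) R))).has_min _ hne
    let N' := powTorsionSubmodule (q := q) N P
    have h1 : (1 : R) ∉ q := fun h => hq.ne_top ((Ideal.eq_top_iff_one _).2 h)
    have hle : N ≤ N' := fun m hm =>
      ⟨1, h1, 0, fun s _ => smul_mem_submodule N _ (smul_mem_submodule N _ hm)⟩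
    have hlt : N < N' := by
      refine lt_of_le_of_ne hle fun he => ?_
      have hxN : x ∈ N' := ⟨1, h1, 1, fun s hs => by
        rw [pow_one] at hs
        exact smul_mem_submodule N _ ((hx s).1 hs)⟩
      rw [← he] at hxN
      exact hP.ne_top ((Ideal.eq_top_iff_one _).2 ((hx 1).2 (by rwa [one_smul])))
    refine ((Set.finite_singleton P).union
      (ih ⟨N', saturated_powTorsionSubmodule N P⟩ hlt)).subset ?_
    rintro P' ⟨hP', hPq', x', hx'⟩
    by_cases hPP : P' = P
    · exact Or.inl hPP
    refine Or.inr ⟨hP', hPq', x', fun s => ⟨fun hs => hle ((hx' s).1 hs), ?_⟩⟩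
    rintro ⟨r, hr, k, hk⟩
    by_contra hs
    have h2 : P ^ k ≤ P' := fun u hu => by
      have h3 := hk u hu
      rw [← mul_smul, ← mul_smul, ← hx'] at h3
      refine ((hP'.mem_or_mem h3).resolve_right hs |> hP'.mem_or_mem).resolve_left
        (C_notMem_of_comap hPq' hr)
    have h3 : P ≤ P' := hP'.le_of_pow_le h2
    exact hmax P' ⟨hP', hPq', x', hx'⟩ (lt_of_le_of_ne h3 (Ne.symm hPP))

/-- A module of bounded growth has only finitely many associated primes over `q`. -/
lemma HasGrowth.finite_associatedPrimes [IsNoetherianRing R] [hq : q.IsPrime]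
    (h : HasGrowth n q M) :
    {P ∈ associatedPrimes (MvPolynomial (Fin n) R) M | P.comap C = q}.Finite := by
  -- The associated primes over `q` do not change modulo the `R ⧸ q`-torsion, which is saturated.
  refine (finite_assOver h ⟨powTorsionSubmodule ⊥ ⊤, saturated_powTorsionSubmodule _ _⟩).subset ?_
  rintro P ⟨hP, hPq⟩
  obtain ⟨hP, x, hx⟩ := LocalCohomologyElements.isAssociatedPrime_iff_exists.1 hP
  refine ⟨hP, hPq, x, fun s => ⟨fun hs => ?_, ?_⟩⟩
  · rw [(hx s).1 hs]
    exact Submodule.zero_mem _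
  · rintro ⟨r, hr, k, hk⟩
    have := hk 1 (by rw [Ideal.top_pow]; exact Submodule.mem_top)
    rw [one_smul, Submodule.mem_bot, ← mul_smul, ← hx] at this
    exact (hP.mem_or_mem this).resolve_left (C_notMem_of_comap hPq hr)

end HasseOperators
end

/-! ### Modules of bounded growth and their extensions -/

open Finset

noncomputable section

namespace HasseOperators

open MvPolynomial (C X)

variable {R : Type u} [CommRing R] {n : ℕ} {q : Ideal R}
  {M : Type u} [AddCommGroup M] [Module (MvPolynomial (Fin n) R) M] [Module (DOp R n) M]
  [IsScalarTower (MvPolynomial (Fin n) R) (DOp R n) M]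
  {N : Type u} [AddCommGroup N] [Module (MvPolynomial (Fin n) R) N] [Module (DOp R n) N]
  [IsScalarTower (MvPolynomial (Fin n) R) (DOp R n) N]

lemma HasGrowth.of_injective (h : HasGrowth n q N) (φ : M →ₗ[DOp R n] N)
    (hφ : Function.Injective φ) : HasGrowth n q M := by
  obtain ⟨hkill, F, hF, c, hc⟩ := h
  have hS : ∀ (f : MvPolynomial (Fin n) R) m, φ (f • m) = f • φ m := fun f m =>
    φ.map_smul_of_tower f m
  refine ⟨fun r hr m => hφ (by rw [hS, hkill r hr, map_zero]),
    fun j => (F j).comap φ.toAddMonoidHom, ⟨fun j k hjk m hm => hF.mono hjk hm,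
      fun m => hF.exhaust (φ m), ?_, ?_, ?_⟩, c, ?_⟩
  · intro j r m hm
    change φ _ ∈ F j
    rw [hS]
    exact hF.C_smul j r _ hm
  · intro j i m hm
    change φ _ ∈ F _
    rw [hS]
    exact hF.X_smul j i _ hm
  · intro j b m hm
    change φ _ ∈ F _
    rw [map_smul]
    exact hF.d_smul j b _ hm
  · intro j m v hv hi
    refine hc j m (fun k => φ (v k)) hv fun a ha => hi a ?_
    rw [AddSubgroup.mem_bot] at ha ⊢
    refine hφ ?_
    rw [map_sum, map_zero, ← ha]
    simp only [hS]

lemma HasGrowth.of_surjective (h : HasGrowth n q M) (φ : M →ₗ[DOp R n] N)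
    (hφ : Function.Surjective φ) : HasGrowth n q N := by
  obtain ⟨hkill, F, hF, c, hc⟩ := h
  have hS : ∀ (f : MvPolynomial (Fin n) R) m, φ (f • m) = f • φ m := fun f m =>
    φ.map_smul_of_tower f m
  refine ⟨fun r hr m => ?_, fun j => (F j).map φ.toAddMonoidHom,
    ⟨fun j k hjk => AddSubgroup.map_mono (hF.mono hjk), ?_, ?_, ?_, ?_⟩, c, ?_⟩
  · obtain ⟨m, rfl⟩ := hφ m
    rw [← hS, hkill r hr, map_zero]
  · intro m
    obtain ⟨m, rfl⟩ := hφ m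
    obtain ⟨j, hj⟩ := hF.exhaust m
    exact ⟨j, m, hj, rfl⟩
  · rintro j r _ ⟨m, hm, rfl⟩
    exact ⟨_, hF.C_smul j r _ hm, hS _ _⟩
  · rintro j i _ ⟨m, hm, rfl⟩
    exact ⟨_, hF.X_smul j i _ hm, hS _ _⟩
  · rintro j b _ ⟨m, hm, rfl⟩
    exact ⟨_, hF.d_smul j b _ hm, map_smul φ _ _⟩
  · intro j m v hv hi
    choose w hw hwv using hv
    refine hc j m w hw fun a ha => hi a ?_
    rw [AddSubgroup.mem_bot] at ha ⊢
    rw [← map_zero φ, ← ha, map_sum]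
    exact Finset.sum_congr rfl fun k _ => by rw [hS, ← hwv]; rfl

omit [IsScalarTower (MvPolynomial (Fin n) R) (DOp R n) M] in
lemma IsBernsteinFiltration.smul_mem {F : ℕ → AddSubgroup M} (hF : IsBernsteinFiltration n R F)
    {f : MvPolynomial (Fin n) R} {e : ℕ} (hf : f.totalDegree ≤ e) {j : ℕ} {m : M}
    (hm : m ∈ F j) : f • m ∈ F (j + e) := by
  rw [f.as_sum, Finset.sum_smul]
  refine (F _).sum_mem fun a ha => ?_
  rw [← mul_one (MvPolynomial.coeff a f), ← MvPolynomial.C_mul_monomial, mul_smul]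
  refine hF.C_smul _ _ _ (hF.mono (Nat.add_le_add_left ?_ j) (hF.monomial_smul a hm))
  exact (MvPolynomial.le_totalDegree ha).trans hf

/-- The fractions `m / f ^ j`. -/
def frac (M : Type u) [AddCommGroup M] [Module (MvPolynomial (Fin n) R) M]
    (f : MvPolynomial (Fin n) R) (j : ℕ) :
    M →ₗ[MvPolynomial (Fin n) R] LocalizedModule (Submonoid.powers f) M :=
  LocalizedModule.divBy (Submonoid.pow f j) ∘ₗ LocalizedModule.mkLinearMap _ M

section frac

variable (f : MvPolynomial (Fin n) R)

omit [Module (DOp R n) M] [IsScalarTower (MvPolynomial (Fin n) R) (DOp R n) M]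

lemma frac_apply (j : ℕ) (m : M) : frac M f j m = LocalizedModule.mk m (Submonoid.pow f j) := by
  rw [frac, LinearMap.comp_apply, LocalizedModule.divBy_apply, LocalizedModule.mkLinearMap_apply,
    LocalizedModule.liftOn_mk, one_mul]

lemma frac_zero (m : M) : frac M f 0 m = LocalizedModule.mk m 1 := by
  rw [frac_apply]
  congr 1

lemma exists_frac (x : LocalizedModule (Submonoid.powers f) M) : ∃ j m, frac M f j m = x := by
  induction x using LocalizedModule.induction_on with
  | _ m s =>
    obtain ⟨_, j, rfl⟩ := s
    exact ⟨j, m, frac_apply f j m⟩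

lemma frac_succ_smul (j : ℕ) (m : M) : frac M f (j + 1) (f • m) = frac M f j m := by
  rw [frac_apply, frac_apply, LocalizedModule.mk_eq]
  refine ⟨1, ?_⟩
  simp only [one_smul]
  change f ^ j • f • m = f ^ (j + 1) • m
  rw [pow_succ, mul_smul]

lemma frac_add_smul (j i : ℕ) (m : M) : frac M f (j + i) (f ^ i • m) = frac M f j m := by
  induction i generalizing m with
  | zero => simp
  | succ i ih => rw [pow_succ, mul_smul, ← add_assoc, ← smul_comm f, frac_succ_smul, ih]

lemma smul_localized_injective :
    Function.Injective fun x : LocalizedModule (Submonoid.powers f) M => f • x := by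
  have h := (Module.End.isUnit_iff _).1 (IsLocalizedModule.map_units
    (LocalizedModule.mkLinearMap (Submonoid.powers f) M) (⟨f, Submonoid.mem_powers f⟩ :
      Submonoid.powers f))
  exact h.1

end frac

/-- The fractions `m / f ^ j` with numerator in `F k`. -/
def fracFiltration (F : ℕ → AddSubgroup M) (f : MvPolynomial (Fin n) R) (j k : ℕ) :
    AddSubgroup (LocalizedModule (Submonoid.powers f) M) :=
  (F k).map (frac M f j).toAddMonoidHom

section fracFiltration

variable {F : ℕ → AddSubgroup M} (hF : IsBernsteinFiltration n R F)
  {f : MvPolynomial (Fin n) R} {e : ℕ}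
include hF

omit [IsScalarTower (MvPolynomial (Fin n) R) (DOp R n) M] in
lemma fracFiltration_mono {j k k' : ℕ} (hk : k ≤ k') :
    fracFiltration F f j k ≤ fracFiltration F f j k' := AddSubgroup.map_mono (hF.mono hk)

omit [IsScalarTower (MvPolynomial (Fin n) R) (DOp R n) M] in
lemma fracFiltration_add (hf : f.totalDegree ≤ e) (j i k : ℕ) :
    fracFiltration F f j k ≤ fracFiltration F f (j + i) (k + i * e) := by
  rintro _ ⟨m, hm, rfl⟩
  refine ⟨f ^ i • m, hF.smul_mem ((MvPolynomial.totalDegree_pow f i).trans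
    (Nat.mul_le_mul_left i hf)) hm, frac_add_smul f j i m⟩

omit [IsScalarTower (MvPolynomial (Fin n) R) (DOp R n) M] in
lemma fracFiltration_smul {g : MvPolynomial (Fin n) R} (hg : g.totalDegree ≤ e) {j k : ℕ}
    {x : LocalizedModule (Submonoid.powers f) M} (hx : x ∈ fracFiltration F f j k) :
    g • x ∈ fracFiltration F f j (k + e) := by
  obtain ⟨m, hm, rfl⟩ := hx
  exact ⟨g • m, hF.smul_mem hg hm, map_smul (frac M f j) g m⟩

/-- The operator `∂_b` raises the exponent of the denominator by at most `|b|` and the degree of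
the numerator by at most `(e + 1)|b|`. The Leibniz rule for `f • (m / f ^ (j + 1)) = m / f ^ j`
reduces to smaller `j` and `b`. -/
lemma fracFiltration_d_smul (he : ∀ b, (hasse b f).totalDegree ≤ e) (j : ℕ) :
    ∀ (k : ℕ) (b : Fin n →₀ ℕ), ∀ x ∈ fracFiltration F f j k,
      (DOp.d b : DOp R n) • x ∈ fracFiltration F f (j + b.degree) (k + (e + 1) * b.degree) := by
  have hf : f.totalDegree ≤ e := by simpa only [hasse_zero] using he 0
  induction j with
  | zero =>
    rintro k b _ ⟨m, hm, rfl⟩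
    have h1 : (DOp.d b : DOp R n) • frac M f 0 m = frac M f 0 ((DOp.d b : DOp R n) • m) := by
      rw [frac_zero, frac_zero, ← DOp.mkLoc_apply, ← DOp.mkLoc_apply, map_smul]
    refine fracFiltration_mono hF (k := k + b.degree + b.degree * e) (le_of_eq (by ring))
      (fracFiltration_add hF hf 0 b.degree _ ?_)
    exact ⟨_, hF.d_smul k b m hm, h1.symm⟩
  | succ j ihj =>
    intro k b
    induction hd : b.degree using Nat.strong_induction_on generalizing b with
    | _ d ih =>
      subst hd
      rintro _ ⟨m, hm, rfl⟩
      have hmem : frac M f (j + 1) m ∈ fracFiltration F f (j + 1) k := ⟨m, hm, rfl⟩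
      change (DOp.d b : DOp R n) • frac M f (j + 1) m ∈ _
      have h1 : f • frac M f (j + 1) m = frac M f j m := by rw [← map_smul, frac_succ_smul]
      have h2 := ihj k b (frac M f j m) ⟨m, hm, rfl⟩
      rw [← h1, DOp.d_smul_smul, ← Finset.add_sum_erase _ _ (a := (0, b)) (by simp)] at h2
      simp only [hasse_zero] at h2
      have h3 : f • (DOp.d b : DOp R n) • frac M f (j + 1) m ∈
          fracFiltration F f (j + b.degree) (k + (e + 1) * b.degree) := by
        refine (AddSubgroup.add_mem_cancel_right _ (AddSubgroup.sum_mem _ ?_)).1 h2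
        rintro ⟨c1, c2⟩ hc
        obtain ⟨hne, hc⟩ := Finset.mem_erase.1 hc
        rw [HasAntidiagonal.mem_antidiagonal] at hc
        have hdeg : c1.degree + c2.degree = b.degree := by rw [← map_add]; exact congrArg _ hc
        have hc1 : c1.degree ≠ 0 := fun h0 => hne <| by
          rw [Finsupp.degree_eq_zero_iff] at h0
          subst h0
          simpa using hc
        obtain ⟨i, hi⟩ : ∃ i, b.degree = c2.degree + i + 1 := ⟨c1.degree - 1, by omega⟩
        have h4 := fracFiltration_add hF hf _ i _
          (fracFiltration_smul hF (he c1) (ih c2.degree (by omega) c2 rfl _ hmem))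
        rw [show j + 1 + c2.degree + i = j + b.degree by omega] at h4
        refine fracFiltration_mono hF ?_ h4
        rw [hi]
        nlinarith [Nat.zero_le i, Nat.zero_le e]
      obtain ⟨m', hm', h5⟩ := h3
      refine ⟨m', hm', smul_localized_injective f ?_⟩
      change f • frac M f _ m' = f • (DOp.d b : DOp R n) • frac M f (j + 1) m
      rw [← map_smul, show j + 1 + b.degree = j + b.degree + 1 by ring, frac_succ_smul]
      exact h5

end fracFiltration

lemma HasGrowth.localization (h : HasGrowth n q M) (f : MvPolynomial (Fin n) R) :
    HasGrowth n q (LocalizedModule (Submonoid.powers f) M) := by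
  obtain ⟨hkill, F, hF, c, hc⟩ := h
  obtain ⟨e, he⟩ : ∃ e, ∀ b, (hasse b f).totalDegree ≤ e := by
    refine ⟨(taylor f).support.sup fun b => (hasse b f).totalDegree, fun b => ?_⟩
    by_cases hb : b ∈ (taylor f).support
    · exact Finset.le_sup (f := fun b => (hasse b f).totalDegree) hb
    · rw [hasse_eq_zero_of_notMem_support f b hb]
      simp
  have hf : f.totalDegree ≤ e := by simpa only [hasse_zero] using he 0
  have hmono : ∀ j i : ℕ, fracFiltration F f j ((e + 1) * j) ≤
      fracFiltration F f (j + i) ((e + 1) * (j + i)) := fun j i =>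
    (fracFiltration_add hF hf j i _).trans (fracFiltration_mono hF (by nlinarith))
  refine ⟨fun r hr x => ?_, fun j => fracFiltration F f j ((e + 1) * j), ⟨?_, ?_, ?_, ?_, ?_⟩,
    c * (e + 1) ^ n, ?_⟩
  · obtain ⟨j, m, rfl⟩ := exists_frac f x
    rw [← map_smul, hkill r hr, map_zero]
  · intro j k hjk
    obtain ⟨i, rfl⟩ := Nat.exists_eq_add_of_le hjk
    exact hmono j i
  · intro x
    obtain ⟨j, m, rfl⟩ := exists_frac f x
    obtain ⟨k, hk⟩ := hF.exhaust m
    refine ⟨j + k, fracFiltration_mono hF ?_ (fracFiltration_add hF hf j k k ⟨m, hk, rfl⟩)⟩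
    nlinarith
  · rintro j r _ ⟨m, hm, rfl⟩
    exact ⟨_, hF.C_smul _ r m hm, map_smul (frac M f j) _ m⟩
  · rintro j i _ ⟨m, hm, rfl⟩
    refine fracFiltration_mono hF (k := (e + 1) * j + 1 + 1 * e) (le_of_eq (by ring))
      (fracFiltration_add hF hf j 1 _ ⟨_, hF.X_smul _ i m hm, map_smul (frac M f j) _ m⟩)
  · intro j b x hx
    have := fracFiltration_d_smul hF he j _ b x hx
    rwa [← mul_add] at this
  · intro j m v hv hi
    choose w hw hwv using hv
    have h1 := hc _ m w hw fun a ha => hi a ?_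
    · refine h1.trans ?_
      rw [mul_assoc, ← mul_pow]
      gcongr
      nlinarith
    · rw [AddSubgroup.mem_bot] at ha ⊢
      rw [← map_zero (frac M f j), ← ha, map_sum]
      exact Finset.sum_congr rfl fun k _ => by rw [map_smul, ← hwv]; rfl

variable (n q) in
/-- The class of modules over the ring of operators obtained by extensions from modules of bounded
growth over `R ⧸ q` and modules killed by an element of `R` outside `q`. -/
inductive Hol : ∀ (M : Type u) [AddCommGroup M] [Module (MvPolynomial (Fin n) R) M]
    [Module (DOp R n) M] [IsScalarTower (MvPolynomial (Fin n) R) (DOp R n) M], Prop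
  | null (M : Type u) [AddCommGroup M] [Module (MvPolynomial (Fin n) R) M]
      [Module (DOp R n) M] [IsScalarTower (MvPolynomial (Fin n) R) (DOp R n) M] (r : R)
      (hr : r ∉ q) (h : ∀ m : M, (C r : MvPolynomial (Fin n) R) • m = 0) : Hol M
  | growth (M : Type u) [AddCommGroup M] [Module (MvPolynomial (Fin n) R) M]
      [Module (DOp R n) M] [IsScalarTower (MvPolynomial (Fin n) R) (DOp R n) M]
      (h : HasGrowth n q M) : Hol M
  | ext (K M L : Type u) [AddCommGroup K] [Module (MvPolynomial (Fin n) R) K]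
      [Module (DOp R n) K] [IsScalarTower (MvPolynomial (Fin n) R) (DOp R n) K]
      [AddCommGroup M] [Module (MvPolynomial (Fin n) R) M]
      [Module (DOp R n) M] [IsScalarTower (MvPolynomial (Fin n) R) (DOp R n) M]
      [AddCommGroup L] [Module (MvPolynomial (Fin n) R) L]
      [Module (DOp R n) L] [IsScalarTower (MvPolynomial (Fin n) R) (DOp R n) L]
      (f : K →ₗ[DOp R n] M) (g : M →ₗ[DOp R n] L) (hf : Function.Injective f)
      (hfg : Function.Exact f g) (hg : Function.Surjective g) (hK : Hol K) (hL : Hol L) : Hol M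

namespace Hol

lemma of_injective (h : Hol n q N) : ∀ {M : Type u} [AddCommGroup M]
    [Module (MvPolynomial (Fin n) R) M] [Module (DOp R n) M]
    [IsScalarTower (MvPolynomial (Fin n) R) (DOp R n) M] (φ : M →ₗ[DOp R n] N)
    (_ : Function.Injective φ), Hol n q M := by
  induction h with
  | null N r hr h =>
    intro M _ _ _ _ φ hφ
    refine null M r hr fun m => hφ ?_
    rw [φ.map_smul_of_tower, h, map_zero]
  | growth N h =>
    intro M _ _ _ _ φ hφ
    exact growth M (h.of_injective φ hφ)
  | ext K N L f g hf hfg hg hK hL ihK ihL =>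
    intro M _ _ _ _ φ hφ
    let A := LinearMap.ker (g ∘ₗ φ)
    let B := LinearMap.range (g ∘ₗ φ)
    refine ext A M B A.subtype (g ∘ₗ φ).rangeRestrict A.injective_subtype ?_
      (LinearMap.surjective_rangeRestrict _) ?_ (ihL B.subtype B.injective_subtype)
    · rw [LinearMap.exact_iff]
      simp [A]
    · have h1 : ∀ x : A, φ x ∈ LinearMap.range f := fun x => (hfg _).1 x.2
      refine ihK ((LinearEquiv.ofInjective f hf).symm.toLinearMap ∘ₗ
        (φ ∘ₗ A.subtype).codRestrict (LinearMap.range f) h1) ?_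
      refine (LinearEquiv.ofInjective f hf).symm.injective.comp fun x y hxy => ?_
      exact Subtype.ext (hφ (congrArg Subtype.val hxy))

lemma of_surjective (h : Hol n q M) : ∀ {N : Type u} [AddCommGroup N]
    [Module (MvPolynomial (Fin n) R) N] [Module (DOp R n) N]
    [IsScalarTower (MvPolynomial (Fin n) R) (DOp R n) N] (φ : M →ₗ[DOp R n] N)
    (_ : Function.Surjective φ), Hol n q N := by
  induction h with
  | null M r hr h =>
    intro N _ _ _ _ φ hφ
    refine null N r hr fun m => ?_
    obtain ⟨m, rfl⟩ := hφ m
    rw [← φ.map_smul_of_tower, h, map_zero]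
  | growth M h =>
    intro N _ _ _ _ φ hφ
    exact growth N (h.of_surjective φ hφ)
  | ext K M L f g hf hfg hg hK hL ihK ihL =>
    intro N _ _ _ _ φ hφ
    let A := LinearMap.range (φ ∘ₗ f)
    refine ext A N (N ⧸ A) A.subtype A.mkQ A.injective_subtype (LinearMap.exact_subtype_mkQ A)
      A.mkQ_surjective (ihK (φ ∘ₗ f).rangeRestrict (LinearMap.surjective_rangeRestrict _)) ?_
    have hker : LinearMap.ker g ≤ LinearMap.ker (A.mkQ ∘ₗ φ) := by
      intro x hx
      obtain ⟨y, rfl⟩ := (hfg x).1 hx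
      rw [LinearMap.mem_ker, LinearMap.comp_apply, Submodule.mkQ_apply,
        Submodule.Quotient.mk_eq_zero]
      exact ⟨y, rfl⟩
    refine ihL ((LinearMap.ker g).liftQ (A.mkQ ∘ₗ φ) hker ∘ₗ
      (g.quotKerEquivOfSurjective hg).symm.toLinearMap) ?_
    intro z
    obtain ⟨y, rfl⟩ := (A.mkQ_surjective.comp hφ) z
    refine ⟨g.quotKerEquivOfSurjective hg ((LinearMap.ker g).mkQ y), ?_⟩
    simp

/-- An extension without injectivity and surjectivity assumptions. -/
lemma of_exact {K L : Type u} [AddCommGroup K] [Module (MvPolynomial (Fin n) R) K]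
    [Module (DOp R n) K] [IsScalarTower (MvPolynomial (Fin n) R) (DOp R n) K]
    [AddCommGroup L] [Module (MvPolynomial (Fin n) R) L]
    [Module (DOp R n) L] [IsScalarTower (MvPolynomial (Fin n) R) (DOp R n) L]
    (f : K →ₗ[DOp R n] M) (g : M →ₗ[DOp R n] L)
    (hfg : Function.Exact f g) (hK : Hol n q K) (hL : Hol n q L) : Hol n q M := by
  refine ext (LinearMap.range f) M (LinearMap.range g) (LinearMap.range f).subtype
    g.rangeRestrict (Submodule.injective_subtype _) ?_ (LinearMap.surjective_rangeRestrict _)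
    (hK.of_surjective f.rangeRestrict (LinearMap.surjective_rangeRestrict _))
    (hL.of_injective (LinearMap.range g).subtype (Submodule.injective_subtype _))
  rw [LinearMap.exact_iff]
  simp [LinearMap.exact_iff.1 hfg]

lemma localization (h : Hol n q M) (f : MvPolynomial (Fin n) R) :
    Hol n q (LocalizedModule (Submonoid.powers f) M) := by
  induction h with
  | null M r hr h =>
    refine null _ r hr fun x => ?_
    obtain ⟨j, m, rfl⟩ := exists_frac f x
    rw [← map_smul, h, map_zero]
  | growth M h => exact growth _ (h.localization f)
  | ext K M L i g hf hfg hg hK hL ihK ihL =>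
    exact of_exact (DOp.mapLoc _ i) (DOp.mapLoc _ g) (DOp.mapLoc_exact _ i g hfg) ihK ihL

lemma of_subsingleton [hq : q.IsPrime] [Subsingleton M] : Hol n q M :=
  null M 1 (fun h => hq.ne_top ((Ideal.eq_top_iff_one _).2 h)) fun _ => Subsingleton.elim _ _

lemma pi [hq : q.IsPrime] {k : ℕ} : ∀ (M : Fin k → Type u) [∀ i, AddCommGroup (M i)]
    [∀ i, Module (MvPolynomial (Fin n) R) (M i)] [∀ i, Module (DOp R n) (M i)]
    [∀ i, IsScalarTower (MvPolynomial (Fin n) R) (DOp R n) (M i)]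
    (_ : ∀ i, Hol n q (M i)), Hol n q (∀ i, M i) := by
  induction k with
  | zero => intro M _ _ _ _ h; exact of_subsingleton
  | succ k ih =>
    intro M _ _ _ _ h
    refine of_exact (LinearMap.single (DOp R n) M 0)
      (LinearMap.pi fun i : Fin k => LinearMap.proj i.succ) ?_ (h 0)
      (ih (fun i : Fin k => M i.succ) fun i => h i.succ)
    intro x
    constructor
    · intro hx
      refine ⟨x 0, funext fun i => ?_⟩
      refine Fin.cases ?_ (fun i => ?_) i
      · simp
      · have : x i.succ = 0 := congrFun hx i
        simp [this]
    · rintro ⟨y, rfl⟩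
      ext i
      simp

lemma finite_associatedPrimes [IsNoetherianRing R] [hq : q.IsPrime] (h : Hol n q M) :
    {P ∈ associatedPrimes (MvPolynomial (Fin n) R) M | P.comap C = q}.Finite := by
  induction h with
  | null M r hr h =>
    refine Set.finite_empty.subset ?_
    rintro P ⟨hP, hPq⟩
    obtain ⟨hP, x, hx⟩ := LocalCohomologyElements.isAssociatedPrime_iff_exists.1 hP
    exact C_notMem_of_comap hPq hr ((hx _).2 (h x))
  | growth M h => exact h.finite_associatedPrimes
  | ext K M L f g hf hfg hg hK hL ihK ihL =>
    refine (ihK.union ihL).subset ?_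
    rintro P ⟨hP, hPq⟩
    have := associatedPrimes.subset_union_of_exact
      (f := f.restrictScalars (MvPolynomial (Fin n) R))
      (g := g.restrictScalars (MvPolynomial (Fin n) R)) hf hfg hP
    exact this.imp (fun h => ⟨h, hPq⟩) fun h => ⟨h, hPq⟩

end Hol

end HasseOperators
end

/-! ### Extension of scalars, and multiplication by a constant -/

open Finset

noncomputable section

namespace HasseOperators

open MvPolynomial (C X)
open scoped TensorProduct

variable {R : Type u} [CommRing R] {n : ℕ} {q : Ideal R}

instance : Module (DOp R n) (MvPolynomial (Fin n) R) :=
  DOp.module (fun b => AddMonoidHom.mk' (hasse b) (hasse_add b)) hasse_zero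
    fun b f m => hasse_mul b f m

instance : IsScalarTower (MvPolynomial (Fin n) R) (DOp R n) (MvPolynomial (Fin n) R) :=
  DOp.module_isScalarTower _ _ _

lemma d_smul_polynomial (b : Fin n →₀ ℕ) (f : MvPolynomial (Fin n) R) :
    (DOp.d b : DOp R n) • f = hasse b f :=
  DOp.module_d_smul (fun b => AddMonoidHom.mk' (hasse b) (hasse_add b)) hasse_zero
    (fun b f m => hasse_mul b f m) b f

section scalar

variable {M : Type u} [AddCommGroup M] [Module (MvPolynomial (Fin n) R) M] [Module (DOp R n) M]
  [IsScalarTower (MvPolynomial (Fin n) R) (DOp R n) M]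
  {N : Type u} [AddCommGroup N] [Module (MvPolynomial (Fin n) R) N] [Module (DOp R n) N]
  [IsScalarTower (MvPolynomial (Fin n) R) (DOp R n) N]

variable (n M) in
/-- Multiplication by a constant, which commutes with the operators `∂_b`. -/
def scalar (r : R) : M →ₗ[DOp R n] M :=
  DOp.linearMap (LinearMap.lsmul (MvPolynomial (Fin n) R) M (C r)) fun b m =>
    (DOp.d_smul_C_smul b r m).symm

lemma scalar_apply (r : R) (m : M) :
    scalar n M r m = (C r : MvPolynomial (Fin n) R) • m := rfl

lemma map_scalar (φ : M →ₗ[DOp R n] N) (r : R) (m : M) :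
    φ (scalar n M r m) = scalar n N r (φ m) := φ.map_smul_of_tower (C r) m

end scalar

instance : SMulCommClass R (DOp R n) (MvPolynomial (Fin n) R) where
  smul_comm r D f := by
    rw [MvPolynomial.smul_eq_C_mul, MvPolynomial.smul_eq_C_mul]
    exact (scalar n (MvPolynomial (Fin n) R) r).map_smul D f

section tensor

variable {N : Type u} [AddCommGroup N] [Module R N] {N' : Type u} [AddCommGroup N'] [Module R N']

lemma d_smul_tmul (b : Fin n →₀ ℕ) (f : MvPolynomial (Fin n) R) (x : N) :
    (DOp.d b : DOp R n) • (f ⊗ₜ[R] x) = hasse b f ⊗ₜ x := by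
  rw [TensorProduct.smul_tmul', d_smul_polynomial]

lemma C_smul_tmul (r : R) (f : MvPolynomial (Fin n) R) (x : N) :
    (C r : MvPolynomial (Fin n) R) • (f ⊗ₜ[R] x) = f ⊗ₜ (r • x) := by
  rw [TensorProduct.smul_tmul', smul_eq_mul, ← MvPolynomial.smul_eq_C_mul,
    TensorProduct.smul_tmul]

lemma C_smul_tensor_eq_zero {r : R} (h : ∀ x : N, r • x = 0)
    (m : MvPolynomial (Fin n) R ⊗[R] N) : (C r : MvPolynomial (Fin n) R) • m = 0 := by
  induction m using TensorProduct.induction_on with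
  | zero => rw [smul_zero]
  | tmul f x => rw [C_smul_tmul, h, TensorProduct.tmul_zero]
  | add x y hx hy => rw [smul_add, hx, hy, add_zero]

variable (n) in
/-- Extension of scalars to `R[x]`, as a map of modules over the ring of operators. -/
def tensorMap (φ : N →ₗ[R] N') :
    MvPolynomial (Fin n) R ⊗[R] N →ₗ[DOp R n] MvPolynomial (Fin n) R ⊗[R] N' :=
  DOp.linearMap (TensorProduct.AlgebraTensorModule.lTensor (MvPolynomial (Fin n) R)
    (MvPolynomial (Fin n) R) φ) fun b m => by
      induction m using TensorProduct.induction_on with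
      | zero => rw [smul_zero, map_zero, smul_zero]
      | tmul f x =>
        rw [d_smul_tmul, TensorProduct.AlgebraTensorModule.lTensor_tmul,
          TensorProduct.AlgebraTensorModule.lTensor_tmul, d_smul_tmul]
      | add x y hx hy => rw [smul_add, map_add, hx, hy, map_add, smul_add]

lemma tensorMap_tmul (φ : N →ₗ[R] N') (f : MvPolynomial (Fin n) R) (x : N) :
    tensorMap n φ (f ⊗ₜ x) = f ⊗ₜ φ x := rfl

lemma tensorMap_exact {N'' : Type u} [AddCommGroup N''] [Module R N''] (φ : N →ₗ[R] N')
    (ψ : N' →ₗ[R] N'') (h : Function.Exact φ ψ) :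
    Function.Exact (tensorMap n φ) (tensorMap n ψ) :=
  Module.Flat.lTensor_exact (MvPolynomial (Fin n) R) h

lemma hasse_mem_restrictDegree {f : MvPolynomial (Fin n) R} {j : ℕ}
    (hf : f ∈ MvPolynomial.restrictDegree (Fin n) R j) (b : Fin n →₀ ℕ) :
    hasse b f ∈ MvPolynomial.restrictDegree (Fin n) R j := by
  have h : hasse b f = ∑ a ∈ f.support,
      C (MvPolynomial.coeff a f) * hasse b (MvPolynomial.monomial a (1 : R)) := by
    conv_lhs => rw [f.as_sum]
    refine (map_sum (AddMonoidHom.mk' (hasse b) (hasse_add b)) _ _).trans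
      (Finset.sum_congr rfl fun a _ => ?_)
    rw [← hasse_C_mul, MvPolynomial.C_mul_monomial, mul_one]
    rfl
  rw [h]
  refine Submodule.sum_mem _ fun a ha => ?_
  rw [← MvPolynomial.smul_eq_C_mul]
  refine Submodule.smul_mem _ _ ((MvPolynomial.mem_restrictDegree _ _ _).2 fun c hc i => ?_)
  exact ((hasse_monomial a).1 b c hc i).trans
    ((MvPolynomial.mem_restrictDegree _ _ _).1 hf a ha i)

lemma tmul_eq_zero_of_coeff {e : N} (he : ∀ r ∈ q, r • e = 0) {f : MvPolynomial (Fin n) R}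
    (hf : ∀ a, MvPolynomial.coeff a f ∈ q) : f ⊗ₜ[R] e = 0 := by
  rw [f.as_sum, TensorProduct.sum_tmul]
  refine Finset.sum_eq_zero fun a _ => ?_
  rw [← mul_one (MvPolynomial.coeff a f), ← MvPolynomial.C_mul_monomial,
    ← MvPolynomial.smul_eq_C_mul, TensorProduct.smul_tmul, he _ (hf a), TensorProduct.tmul_zero]

/-- The polynomial ring over `R ⧸ q` has growth of order `n`, for the filtration by the degree in
each variable. -/
lemma hasGrowth_tensor [hq : q.IsPrime] (e : N) (he : ∀ x : N, ∃ r : R, r • e = x)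
    (hqe : ∀ r ∈ q, r • e = 0) : HasGrowth n q (MvPolynomial (Fin n) R ⊗[R] N) := by
  have hqN : ∀ r ∈ q, ∀ x : N, r • x = 0 := fun r hr x => by
    obtain ⟨s, rfl⟩ := he x
    rw [smul_comm, hqe r hr, smul_zero]
  have hsurj : ∀ m : MvPolynomial (Fin n) R ⊗[R] N, ∃ f, f ⊗ₜ e = m := by
    intro m
    induction m using TensorProduct.induction_on with
    | zero => exact ⟨0, TensorProduct.zero_tmul _ _⟩
    | tmul f x =>
      obtain ⟨r, rfl⟩ := he x
      exact ⟨r • f, TensorProduct.smul_tmul _ _ _⟩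
    | add x y hx hy =>
      obtain ⟨f, rfl⟩ := hx
      obtain ⟨g, rfl⟩ := hy
      exact ⟨f + g, TensorProduct.add_tmul _ _ _⟩
  refine ⟨fun r hr m => C_smul_tensor_eq_zero (hqN r hr) m,
    fun j => (MvPolynomial.restrictDegree (Fin n) R j).toAddSubgroup.map
      ((TensorProduct.mk R (MvPolynomial (Fin n) R) N).flip e).toAddMonoidHom,
    ⟨?_, ?_, ?_, ?_, ?_⟩, 1, ?_⟩
  · refine fun j k hjk => AddSubgroup.map_mono fun f hf => ?_
    exact (MvPolynomial.mem_restrictDegree _ _ _).2 fun a ha i =>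
      ((MvPolynomial.mem_restrictDegree _ _ _).1 hf a ha i).trans hjk
  · intro m
    obtain ⟨f, rfl⟩ := hsurj m
    exact ⟨f.totalDegree, f, MvPolynomial.restrictTotalDegree_le_restrictDegree (Fin n) _ _
      ((MvPolynomial.mem_restrictTotalDegree _ _ _).2 le_rfl), rfl⟩
  · rintro j r _ ⟨f, hf, rfl⟩
    refine ⟨r • f, Submodule.smul_mem _ r hf, ?_⟩
    rw [MvPolynomial.smul_eq_C_mul]
    rfl
  · rintro j i _ ⟨f, hf, rfl⟩
    refine ⟨X i * f, (MvPolynomial.mem_restrictDegree _ _ _).2 fun a ha k => ?_, rfl⟩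
    rw [MvPolynomial.support_X_mul] at ha
    obtain ⟨c, hc, rfl⟩ := Finset.mem_map.1 ha
    have h1 := (MvPolynomial.mem_restrictDegree _ _ _).1 hf c hc k
    have h2 : (Finsupp.single i 1 : Fin n →₀ ℕ) k ≤ 1 := by
      rw [Finsupp.single_apply]
      split_ifs <;> simp
    simp only [addLeftEmbedding_apply, Finsupp.add_apply]
    omega
  · rintro j b _ ⟨f, hf, rfl⟩
    refine ⟨hasse b f, (MvPolynomial.mem_restrictDegree _ _ _).2 fun a ha k => ?_,
      (d_smul_tmul b f e).symm⟩
    exact ((MvPolynomial.mem_restrictDegree _ _ _).1 (hasse_mem_restrictDegree hf b) a ha k).trans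
      (Nat.le_add_right _ _)
  · intro j m v hv hi
    choose f hf hfv using hv
    by_contra! hlt
    obtain ⟨a, ⟨k, hk⟩, ha⟩ := exists_relation (q := q)
      (fun (k : Fin m) (i : Fin n → Fin (j + 1)) => MvPolynomial.coeff (boxExp i) (f k)) (by
        simpa using hlt)
    refine hk (hi a ?_ k)
    rw [AddSubgroup.mem_bot]
    have h1 : ∑ k, (C (a k) : MvPolynomial (Fin n) R) • v k = (∑ k, C (a k) * f k) ⊗ₜ e := by
      rw [TensorProduct.sum_tmul]
      exact Finset.sum_congr rfl fun k _ => by rw [← hfv k]; rfl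
    rw [h1]
    refine tmul_eq_zero_of_coeff hqe fun c => ?_
    simp only [MvPolynomial.coeff_sum, MvPolynomial.coeff_C_mul]
    by_cases hc : ∀ i, c i ≤ j
    · convert ha fun i => ⟨c i, Nat.lt_succ_of_le (hc i)⟩ using 4
      ext i
      rfl
    · rw [Finset.sum_eq_zero]
      · exact q.zero_mem
      · intro k _
        rw [show MvPolynomial.coeff c (f k) = 0 from ?_, mul_zero]
        by_contra h0
        exact hc fun i => (MvPolynomial.mem_restrictDegree _ _ _).1 (hf k) c
          (MvPolynomial.mem_support_iff.2 h0) i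

/-- For `q` minimal over `τ`, the polynomials with coefficients in a finite module killed by `τ`
have a finite filtration by modules of bounded growth and modules killed outside `q`. -/
lemma hol_tensor [IsNoetherianRing R] [hq : q.IsPrime] {τ : R}
    (hτ : q ∈ (Ideal.span {τ}).minimalPrimes) [hN : Module.Finite R N] :
    (∀ x : N, τ • x = 0) → Hol n q (MvPolynomial (Fin n) R ⊗[R] N) := by
  induction hN using IsNoetherianRing.induction_on_isQuotientEquivQuotientPrime R with
  | subsingleton N =>
    intro _
    exact Hol.null _ 1 (fun h => hq.ne_top ((Ideal.eq_top_iff_one _).2 h))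
      (C_smul_tensor_eq_zero fun _ => Subsingleton.elim _ _)
  | quotient N p φ =>
    intro h
    have hp : ∀ r, r ∈ p.1 ↔ ∀ x : N, r • x = 0 := by
      intro r
      constructor
      · intro hr x
        refine φ.injective ?_
        obtain ⟨y, hy⟩ := Ideal.Quotient.mk_surjective (φ x)
        rw [map_smul, map_zero, ← hy, ← Ideal.Quotient.mk_eq_mk, ← Submodule.Quotient.mk_smul,
          Submodule.Quotient.mk_eq_zero]
        exact Ideal.mul_mem_right _ _ hr
      · intro hr
        have h1 := congrArg φ (hr (φ.symm 1))
        rw [map_smul, φ.apply_symm_apply, map_zero, ← map_one (Ideal.Quotient.mk p.1),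
          ← Ideal.Quotient.mk_eq_mk, ← Submodule.Quotient.mk_smul,
          Submodule.Quotient.mk_eq_zero, smul_eq_mul, mul_one] at h1
        exact h1
    by_cases hpq : p.1 ≤ q
    · have hqp : q ≤ p.1 := hτ.2 ⟨p.2, (Ideal.span_singleton_le_iff_mem _).2 ((hp τ).2 h)⟩ hpq
      refine Hol.growth _ (hasGrowth_tensor (φ.symm 1) (fun x => ?_)
        fun r hr => (hp r).1 (hqp hr) _)
      obtain ⟨r, hr⟩ := Ideal.Quotient.mk_surjective (φ x)
      refine ⟨r, φ.injective ?_⟩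
      rw [map_smul, φ.apply_symm_apply, ← hr, Algebra.smul_def, mul_one]
      rfl
    · obtain ⟨r, hr, hrq⟩ := SetLike.not_le_iff_exists.1 hpq
      exact Hol.null _ r hrq (C_smul_tensor_eq_zero ((hp r).1 hr))
  | exact N₁ N₂ N₃ f g hf hg hfg h₁ h₃ =>
    intro h
    refine Hol.of_exact (tensorMap n f) (tensorMap n g) (tensorMap_exact f g hfg)
      (h₁ fun x => hf ?_) (h₃ fun x => ?_)
    · rw [map_smul, h, map_zero]
    · obtain ⟨x, rfl⟩ := hg x
      rw [← map_smul, h, map_zero]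

end tensor

section TorsionCotorsion

variable {M : Type u} [AddCommGroup M] [Module (MvPolynomial (Fin n) R) M] [Module (DOp R n) M]
  [IsScalarTower (MvPolynomial (Fin n) R) (DOp R n) M]

variable (n q M) in
/-- The kernel and the cokernel of multiplication by `τ` belong to the class `Hol`. -/
def HolModulo (τ : R) : Prop :=
  Hol n q (LinearMap.ker (scalar n M τ)) ∧ Hol n q (M ⧸ LinearMap.range (scalar n M τ))

lemma HolModulo.of_exact {τ : R} {A B : Type u} [AddCommGroup A]
    [Module (MvPolynomial (Fin n) R) A] [Module (DOp R n) A]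
    [IsScalarTower (MvPolynomial (Fin n) R) (DOp R n) A] [AddCommGroup B]
    [Module (MvPolynomial (Fin n) R) B] [Module (DOp R n) B]
    [IsScalarTower (MvPolynomial (Fin n) R) (DOp R n) B] (a : A →ₗ[DOp R n] M)
    (b : M →ₗ[DOp R n] B) (ha : Function.Exact a (scalar n M τ))
    (hb : Function.Exact (scalar n M τ) b) (hA : Hol n q A) (hB : Hol n q B) :
    HolModulo n q M τ := by
  constructor
  · refine hA.of_surjective (a.codRestrict _ fun x => (ha _).2 ⟨x, rfl⟩) ?_
    rintro ⟨x, hx⟩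
    obtain ⟨y, rfl⟩ := (ha x).1 hx
    exact ⟨y, rfl⟩
  · rw [LinearMap.exact_iff] at hb
    refine hB.of_injective (Submodule.liftQ _ b hb.ge) ?_
    rw [← LinearMap.ker_eq_bot]
    exact Submodule.ker_liftQ_eq_bot _ _ _ hb.le

lemma exact_subtype_scalar (τ : R) :
    Function.Exact (LinearMap.ker (scalar n M τ)).subtype (scalar n M τ) := by
  rw [LinearMap.exact_iff, Submodule.range_subtype]

lemma exact_scalar_mkQ (τ : R) :
    Function.Exact (scalar n M τ) (LinearMap.range (scalar n M τ)).mkQ := by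
  rw [LinearMap.exact_iff, Submodule.ker_mkQ]

lemma HolModulo.localization {τ : R} (h : HolModulo n q M τ) (f : MvPolynomial (Fin n) R) :
    HolModulo n q (LocalizedModule (Submonoid.powers f) M) τ := by
  have hs : DOp.mapLoc (Submonoid.powers f) (scalar n M τ) = scalar n _ τ := by
    ext x
    obtain ⟨j, m, rfl⟩ := exists_frac f x
    rw [scalar_apply, ← map_smul, frac_apply, frac_apply, DOp.mapLoc_mk]
    rfl
  have h1 := DOp.mapLoc_exact (Submonoid.powers f) _ _ (exact_subtype_scalar (n := n) (M := M) τ)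
  have h2 := DOp.mapLoc_exact (Submonoid.powers f) _ _ (exact_scalar_mkQ (n := n) (M := M) τ)
  rw [hs] at h1 h2
  exact .of_exact _ _ h1 h2 (h.1.localization f) (h.2.localization f)

lemma HolModulo.pi [q.IsPrime] {τ : R} {k : ℕ} (M : Fin k → Type u) [∀ i, AddCommGroup (M i)]
    [∀ i, Module (MvPolynomial (Fin n) R) (M i)] [∀ i, Module (DOp R n) (M i)]
    [∀ i, IsScalarTower (MvPolynomial (Fin n) R) (DOp R n) (M i)]
    (h : ∀ i, HolModulo n q (M i) τ) : HolModulo n q (∀ i, M i) τ := by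
  refine .of_exact (τ := τ)
    (A := ∀ i, LinearMap.ker (scalar n (M i) τ))
    (B := ∀ i, M i ⧸ LinearMap.range (scalar n (M i) τ))
    (LinearMap.pi fun i => (LinearMap.ker (scalar n (M i) τ)).subtype ∘ₗ LinearMap.proj i)
    (LinearMap.pi fun i => (LinearMap.range (scalar n (M i) τ)).mkQ ∘ₗ LinearMap.proj i) ?_ ?_
    (Hol.pi _ fun i => (h i).1) (Hol.pi _ fun i => (h i).2)
  · intro x
    constructor
    · intro hx
      exact ⟨fun i => ⟨x i, congrFun hx i⟩, rfl⟩
    · rintro ⟨y, rfl⟩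
      exact funext fun i => (y i).2
  · intro x
    constructor
    · intro hx
      choose y hy using fun i =>
        (Submodule.Quotient.mk_eq_zero (LinearMap.range (scalar n (M i) τ))).1 (congrFun hx i)
      exact ⟨y, funext hy⟩
    · rintro ⟨y, rfl⟩
      exact funext fun i => (Submodule.Quotient.mk_eq_zero _).2 ⟨y i, rfl⟩

/-- A part of the snake lemma for multiplication by `τ` on `M → E → E ⧸ M`. -/
lemma HolModulo.quotient_range {E : Type u} [AddCommGroup E] [Module (MvPolynomial (Fin n) R) E]
    [Module (DOp R n) E] [IsScalarTower (MvPolynomial (Fin n) R) (DOp R n) E] {τ : R}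
    (hM : HolModulo n q M τ) (hE : HolModulo n q E τ) (i : M →ₗ[DOp R n] E) :
    HolModulo n q (E ⧸ LinearMap.range i) τ := by
  let I := LinearMap.range i
  let sQ := scalar n (E ⧸ I) τ
  have hsQ : ∀ e, sQ (I.mkQ e) = I.mkQ (scalar n E τ e) := fun e => (map_scalar I.mkQ τ e).symm
  constructor
  · -- The connecting map takes values in the image of `M ⧸ τ M` in `E ⧸ τ I`.
    let W := I.map (scalar n E τ)
    let h : E ⧸ I →ₗ[DOp R n] E ⧸ W := I.mapQ W (scalar n E τ) (Submodule.le_comap_map _ _)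
    have hk : LinearMap.range (scalar n M τ) ≤ LinearMap.ker (W.mkQ ∘ₗ i) := by
      rintro _ ⟨m, rfl⟩
      rw [LinearMap.mem_ker, LinearMap.comp_apply, Submodule.mkQ_apply,
        Submodule.Quotient.mk_eq_zero, map_scalar]
      exact ⟨i m, ⟨m, rfl⟩, rfl⟩
    let k : M ⧸ LinearMap.range (scalar n M τ) →ₗ[DOp R n] E ⧸ W := Submodule.liftQ _ _ hk
    have hmem : ∀ x : LinearMap.ker sQ,
        (h ∘ₗ (LinearMap.ker sQ).subtype) x ∈ LinearMap.range k := by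
      rintro ⟨x, hx⟩
      obtain ⟨e, rfl⟩ := I.mkQ_surjective x
      rw [LinearMap.mem_ker, hsQ, Submodule.mkQ_apply, Submodule.Quotient.mk_eq_zero] at hx
      obtain ⟨m, hm⟩ := hx
      refine ⟨Submodule.Quotient.mk m, ?_⟩
      change Submodule.Quotient.mk (i m) = Submodule.Quotient.mk (scalar n E τ e)
      rw [hm]
    have hj : ∀ x : LinearMap.ker (scalar n E τ),
        (I.mkQ ∘ₗ (LinearMap.ker (scalar n E τ)).subtype) x ∈ LinearMap.ker sQ := by
      rintro ⟨x, hx⟩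
      change sQ (I.mkQ x) = 0
      rw [hsQ, LinearMap.mem_ker.1 hx, map_zero]
    refine Hol.of_exact (LinearMap.codRestrict (LinearMap.ker sQ) _ hj)
      (LinearMap.codRestrict (LinearMap.range k) _ hmem) ?_ hE.1
      (hM.2.of_surjective k.rangeRestrict (LinearMap.surjective_rangeRestrict _))
    rintro ⟨x, hx⟩
    constructor
    · intro hx0
      obtain ⟨e, rfl⟩ := I.mkQ_surjective x
      have h1 : W.mkQ (scalar n E τ e) = 0 := congrArg Subtype.val hx0
      rw [Submodule.mkQ_apply, Submodule.Quotient.mk_eq_zero] at h1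
      obtain ⟨y, hy, hye⟩ := h1
      refine ⟨⟨e - y, ?_⟩, Subtype.ext ?_⟩
      · rw [LinearMap.mem_ker, map_sub, hye, sub_self]
      · change I.mkQ (e - y) = I.mkQ e
        rw [map_sub, sub_eq_self, Submodule.mkQ_apply, Submodule.Quotient.mk_eq_zero]
        exact hy
    · rintro ⟨⟨e, he⟩, h1⟩
      obtain rfl : I.mkQ e = x := congrArg Subtype.val h1
      refine Subtype.ext ?_
      change W.mkQ (scalar n E τ e) = 0
      rw [LinearMap.mem_ker.1 he, map_zero]
  · refine hE.2.of_surjective (Submodule.mapQ _ (LinearMap.range sQ) I.mkQ ?_) ?_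
    · rintro _ ⟨e, rfl⟩
      exact ⟨I.mkQ e, hsQ e⟩
    · intro z
      obtain ⟨x, rfl⟩ := (LinearMap.range sQ).mkQ_surjective z
      obtain ⟨e, rfl⟩ := I.mkQ_surjective x
      exact ⟨Submodule.Quotient.mk e, rfl⟩

/-- The polynomial ring itself: its `τ`-torsion and its reduction modulo `τ` are obtained by
extension of scalars from those of `R`. -/
lemma holModulo_polynomial [IsNoetherianRing R] [hq : q.IsPrime] {τ : R}
    (hτ : q ∈ (Ideal.span {τ}).minimalPrimes) :
    HolModulo n q (MvPolynomial (Fin n) R) τ := by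
  let t : R →ₗ[R] R := LinearMap.lsmul R R τ
  let ρ : MvPolynomial (Fin n) R ⊗[R] R →ₗ[DOp R n] MvPolynomial (Fin n) R :=
    DOp.linearMap (TensorProduct.AlgebraTensorModule.rid R (MvPolynomial (Fin n) R)
      (MvPolynomial (Fin n) R)).toLinearMap fun b m => by
        induction m using TensorProduct.induction_on with
        | zero => rw [smul_zero, map_zero, smul_zero]
        | tmul f x =>
          rw [d_smul_tmul]
          change x • hasse b f = (DOp.d b : DOp R n) • x • f
          rw [← d_smul_polynomial, smul_comm]
        | add x y hx hy => rw [smul_add, map_add, hx, hy, map_add, smul_add]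
  have hρ : Function.Bijective ρ := (TensorProduct.AlgebraTensorModule.rid R
    (MvPolynomial (Fin n) R) (MvPolynomial (Fin n) R)).bijective
  have hts : tensorMap n t = scalar n _ τ := by
    ext m
    induction m using TensorProduct.induction_on with
    | zero => rw [map_zero, map_zero]
    | tmul f x =>
      rw [tensorMap_tmul, scalar_apply, C_smul_tmul]
      rfl
    | add x y hx hy => rw [map_add, map_add, hx, hy]
  have h1 : Function.Exact (LinearMap.ker t).subtype t := by
    rw [LinearMap.exact_iff, Submodule.range_subtype]
  have h2 : Function.Exact t (LinearMap.range t).mkQ := by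
    rw [LinearMap.exact_iff, Submodule.ker_mkQ]
  have h3 := tensorMap_exact (n := n) _ _ h1
  have h4 := tensorMap_exact (n := n) _ _ h2
  rw [hts] at h3 h4
  let e := LinearEquiv.ofBijective ρ hρ
  have he : ∀ x, e (scalar n _ τ x) = scalar n _ τ (e x) := map_scalar ρ τ
  have he' : ∀ x, e.symm (scalar n _ τ x) = scalar n _ τ (e.symm x) :=
    map_scalar e.symm.toLinearMap τ
  refine .of_exact (ρ ∘ₗ tensorMap n (LinearMap.ker t).subtype)
    (tensorMap n (LinearMap.range t).mkQ ∘ₗ e.symm.toLinearMap) (fun x => ?_) (fun x => ?_)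
    (hol_tensor hτ fun x => Subtype.ext x.2) (hol_tensor hτ fun x => ?_)
  · have h5 := h3 (e.symm x)
    rw [← he', LinearEquiv.map_eq_zero_iff] at h5
    rw [h5]
    constructor
    · rintro ⟨y, hy⟩
      exact ⟨y, by rw [LinearMap.comp_apply, hy]; exact e.apply_symm_apply x⟩
    · rintro ⟨y, rfl⟩
      exact ⟨y, (e.symm_apply_apply _).symm⟩
  · refine (h4 (e.symm x)).trans ?_
    constructor
    · rintro ⟨y, hy⟩
      exact ⟨e y, by rw [← he, hy, e.apply_symm_apply]⟩
    · rintro ⟨y, rfl⟩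
      exact ⟨e.symm y, (he' y).symm⟩
  · obtain ⟨y, rfl⟩ := (LinearMap.range t).mkQ_surjective x
    rw [← map_smul, Submodule.mkQ_apply, Submodule.Quotient.mk_eq_zero]
    exact ⟨y, rfl⟩

end TorsionCotorsion

end HasseOperators
end

/-! ### Finiteness for local cohomology -/

open Finset

noncomputable section

namespace HasseOperators

open MvPolynomial (C X)
open CategoryTheory LocalCohomologyElements

variable {R : Type u} [CommRing R] {n : ℕ} {q : Ideal R}
  {M : Type u} [AddCommGroup M] [Module (MvPolynomial (Fin n) R) M]

section Localizations

variable {k : ℕ} (f : Fin k → MvPolynomial (Fin n) R)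

variable (M) in
/-- The product of the localizations of `M` at finitely many elements. -/
abbrev LocProd : Type u := ∀ j, LocalizedModule (Submonoid.powers (f j)) M

lemma smul_divBy (g : MvPolynomial (Fin n) R) (t : ℕ)
    (x : LocalizedModule (Submonoid.powers g) M) :
    g ^ t • LocalizedModule.divBy (Submonoid.pow g t) x = x :=
  LocalizedModule.mul_by_divBy (Submonoid.pow g t) x

/-- Each factor of the product is a module on which some element of `J ^ t` acts invertibly. -/
lemma ext_locProd_eq_zero {J : Ideal (MvPolynomial (Fin n) R)} (hf : ∀ j, f j ∈ J) (t i : ℕ)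
    (ξ : Abelian.Ext (quot J t) (ModuleCat.of (MvPolynomial (Fin n) R) (LocProd M f)) i) :
    ξ = 0 := by
  refine ext_quot_eq_zero univ (fun j => f j ^ t) (fun j => Ideal.pow_mem_pow (hf j) t)
    (fun j => ModuleCat.ofHom (LinearMap.single (MvPolynomial (Fin n) R)
      (fun j => LocalizedModule (Submonoid.powers (f j)) M) j ∘ₗ
        LocalizedModule.divBy (Submonoid.pow (f j) t) ∘ₗ LinearMap.proj j :
          LocProd M f →ₗ[MvPolynomial (Fin n) R] LocProd M f)) ?_ ξ
  refine ModuleCat.hom_ext (LinearMap.ext fun x => ?_)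
  rw [ModuleCat.hom_sum, LinearMap.sum_apply]
  funext l
  refine (Finset.sum_apply l _ _).trans ?_
  rw [Finset.sum_eq_single l]
  · change (f l ^ t • Pi.single l (LocalizedModule.divBy (Submonoid.pow (f l) t) (x l)) :
      ∀ j, LocalizedModule (Submonoid.powers (f j)) M) l = x l
    rw [Pi.smul_apply, Pi.single_eq_same, smul_divBy]
  · intro j _ hj
    change (f j ^ t • Pi.single j (LocalizedModule.divBy (Submonoid.pow (f j) t) (x j)) :
      ∀ j, LocalizedModule (Submonoid.powers (f j)) M) l = 0
    rw [Pi.smul_apply, Pi.single_eq_of_ne hj.symm, smul_zero]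
  · intro h
    exact absurd (mem_univ l) h

variable [Module (DOp R n) M] [IsScalarTower (MvPolynomial (Fin n) R) (DOp R n) M]

lemma HolModulo.locProd [q.IsPrime] {τ : R} (h : HolModulo n q M τ) :
    HolModulo n q (LocProd M f) τ :=
  .pi (fun j => LocalizedModule (Submonoid.powers (f j)) M) fun j => h.localization (f j)

variable (M) in
/-- The diagonal map to the product of localizations. -/
def toLocProd : M →ₗ[DOp R n] LocProd M f :=
  (LinearMap.pi fun j => DOp.mkLoc (Submonoid.powers (f j)) M :
    M →ₗ[DOp R n] ∀ j, LocalizedModule (Submonoid.powers (f j)) M)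

lemma isPowTorsion_ker_toLocProd {J : Ideal (MvPolynomial (Fin n) R)} (hJ : J.FG)
    (hf : Ideal.span (Set.range f) = J) :
    IsPowTorsion J (LinearMap.ker
      ((toLocProd M f).restrictScalars (MvPolynomial (Fin n) R))) := by
  rintro ⟨x, hx⟩
  have h1 : J ≤ Ideal.radical
      (LinearMap.ker (LinearMap.toSpanSingleton (MvPolynomial (Fin n) R) M x)) := by
    rw [← hf, Ideal.span_le]
    rintro _ ⟨j, rfl⟩
    have h2 : LocalizedModule.mk x (1 : Submonoid.powers (f j)) = 0 := congrFun hx j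
    rw [← LocalizedModule.zero_mk 1, LocalizedModule.mk_eq] at h2
    obtain ⟨⟨_, l, rfl⟩, h3⟩ := h2
    simp only [one_smul, smul_zero] at h3
    exact ⟨l, h3⟩
  obtain ⟨t, ht⟩ := Ideal.exists_pow_le_of_le_radical_of_fg h1 hJ
  exact ⟨t, fun r hr => Subtype.ext (ht hr)⟩

end Localizations

variable [Module (DOp R n) M] [IsScalarTower (MvPolynomial (Fin n) R) (DOp R n) M]

/-- Dimension shifting along `M → ∏ M_{f_j}`, whose cokernel is again in the class. -/
lemma finite_associatedPrimes_localCohomology [IsNoetherianRing R] [hq : q.IsPrime] {τ : R}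
    (hτ : τ ∈ q) (J : Ideal (MvPolynomial (Fin n) R)) (i : ℕ) :
    ∀ (M : Type u) [AddCommGroup M] [Module (MvPolynomial (Fin n) R) M] [Module (DOp R n) M]
      [IsScalarTower (MvPolynomial (Fin n) R) (DOp R n) M], HolModulo n q M τ →
      {P ∈ associatedPrimes (MvPolynomial (Fin n) R) ((localCohomology J i).obj
        (ModuleCat.of (MvPolynomial (Fin n) R) M)) | P.comap C = q}.Finite := by
  induction i with
  | zero =>
    intro M _ _ _ _ h
    refine h.1.finite_associatedPrimes.subset ?_
    rintro P ⟨hP, hPq⟩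
    obtain ⟨hP, x, hx⟩ := isAssociatedPrime_iff_exists.1 (isAssociatedPrime_of_zero _ hP)
    have hxτ : (C τ : MvPolynomial (Fin n) R) • x = 0 := (hx _).1 (by rw [← hPq] at hτ; exact hτ)
    exact ⟨isAssociatedPrime_iff_exists.2 ⟨hP, ⟨x, hxτ⟩, fun s =>
      (hx s).trans ⟨fun h => Subtype.ext h, fun h => congrArg Subtype.val h⟩⟩, hPq⟩
  | succ i ih =>
    intro M _ _ _ _ h
    have hJ : J.FG := (isNoetherianRing_iff_ideal_fg _).1 inferInstance J
    obtain ⟨k, f, hf⟩ := Submodule.fg_iff_exists_fin_generating_family.1 hJ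
    have hfJ : ∀ j, f j ∈ J := fun j => hf ▸ Submodule.subset_span ⟨j, rfl⟩
    have hQ := h.quotient_range (h.locProd f) (toLocProd M f)
    have hfin := ih (LocProd M f ⧸ LinearMap.range (toLocProd M f)) hQ
    refine hfin.subset ?_
    rintro P ⟨hP, hPq⟩
    refine ⟨isAssociatedPrime_of_succ
      ((toLocProd M f).restrictScalars (MvPolynomial (Fin n) R))
      ((LinearMap.range (toLocProd M f)).mkQ.restrictScalars (MvPolynomial (Fin n) R))
      ?_ (LinearMap.range (toLocProd M f)).mkQ_surjective
      (isPowTorsion_ker_toLocProd f hJ hf)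
      (fun t i ξ => ext_locProd_eq_zero f hfJ t i ξ) i hP, hPq⟩
    exact (LinearMap.exact_iff.2 (by rw [Submodule.ker_mkQ]) :
      Function.Exact (toLocProd M f) (LinearMap.range (toLocProd M f)).mkQ)

end HasseOperators

end

/-- One of the two symmetric halves of the theorem: a prime containing `τ` but not `σ` lies over one
of the finitely many minimal primes of `τ`. -/
lemma finite_associatedPrimes_of_mem_notMem {R : Type u} [CommRing R] [IsLocalRing R]
    [IsNoetherianRing R] (σ τ : R)
    (hστ : (Ideal.span {σ, τ}).radical = IsLocalRing.maximalIdeal R)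
    (n : ℕ) (J : Ideal (MvPolynomial (Fin n) R)) (i : ℕ) :
    {P ∈ associatedPrimes (MvPolynomial (Fin n) R)
        ((localCohomology J i).obj
          (ModuleCat.of (MvPolynomial (Fin n) R) (MvPolynomial (Fin n) R))) |
      MvPolynomial.C τ ∈ P ∧ MvPolynomial.C σ ∉ P}.Finite := by
  have hm : IsLocalRing.maximalIdeal R ∈ (Ideal.span {σ, τ}).minimalPrimes := by
    refine ⟨⟨inferInstance, hστ ▸ Ideal.le_radical⟩, fun I hI _ => ?_⟩
    rw [← hστ]
    exact hI.1.radical_le_iff.2 hI.2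
  refine Set.Finite.subset (Set.Finite.biUnion
    (Ideal.finite_minimalPrimes_of_isNoetherianRing R (Ideal.span {τ}))
    (t := fun q => {P ∈ associatedPrimes (MvPolynomial (Fin n) R)
        ((localCohomology J i).obj
          (ModuleCat.of (MvPolynomial (Fin n) R) (MvPolynomial (Fin n) R))) |
      P.comap MvPolynomial.C = q}) fun q hq => ?_) ?_
  · have : q.IsPrime := hq.1.1
    exact HasseOperators.finite_associatedPrimes_localCohomology
      (hq.1.2 (Ideal.mem_span_singleton_self τ)) J i _ (HasseOperators.holModulo_polynomial hq)
  · rintro P ⟨hP, hτ, hσ⟩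
    refine Set.mem_biUnion ?_ ⟨hP, rfl⟩
    have hPp : P.IsPrime := hP.isPrime
    have : (P.comap (MvPolynomial.C (σ := Fin n) (R := R))).IsPrime := hPp.comap _
    have hlt : P.comap (MvPolynomial.C (σ := Fin n) (R := R)) < IsLocalRing.maximalIdeal R := by
      refine lt_of_le_of_ne (IsLocalRing.le_maximalIdeal this.ne_top) fun h => hσ ?_
      have h1 : σ ∈ IsLocalRing.maximalIdeal R := hm.1.2 (Ideal.subset_span (by simp))
      rw [← h] at h1
      exact h1
    -- By Krull's height theorem a prime strictly below the maximal ideal, which is minimal over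
    -- `σ` and `τ`, is minimal over `τ` as soon as it contains `τ`.
    exact Ideal.mem_minimalPrimes_span_of_mem_minimalPrimes_span_insert hlt σ {τ} hm {τ}
      (by simpa using hτ) fun x hx => by
        rw [Set.mem_singleton_iff.1 hx]
        exact Ideal.le_radical (Ideal.subset_span (by simp))

theorem theorem3p4 {R : Type u} [CommRing R] [IsLocalRing R] [IsNoetherianRing R]
    (hR : ringKrullDim R = 2) (σ τ : R) (hστ : IsSystemOfParameters ![σ, τ])
    (n : ℕ) (J : Ideal (MvPolynomial (Fin n) R)) (i : ℕ) :
    {P ∈ associatedPrimes (MvPolynomial (Fin n) R)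
        ((localCohomology J i).obj
          (ModuleCat.of (MvPolynomial (Fin n) R) (MvPolynomial (Fin n) R))) |
      (MvPolynomial.C τ ∈ P ∧ MvPolynomial.C σ ∉ P) ∨
        (MvPolynomial.C σ ∈ P ∧ MvPolynomial.C τ ∉ P)}.Finite := by
  have h := hστ.2
  rw [Matrix.range_cons_cons_empty] at h
  have h' := h
  rw [Set.pair_comm] at h'
  refine ((finite_associatedPrimes_of_mem_notMem σ τ h n J i).union
    (finite_associatedPrimes_of_mem_notMem τ σ h' n J i)).subset ?_
  rintro P ⟨hP, h1 | h1⟩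
  · exact Or.inl ⟨hP, h1⟩
  · exact Or.inr ⟨hP, h1⟩
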